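/- Let $\mathcal H_A,\mathcal H_B,\mathcal H_E$ be finite-dimensional complex Hilbert spaces, $d_A=\dim\mathcal H_A$, $\mathcal H_{B'}$ a copy of $\mathcal H_A$ (held by $B$), $1\le L\le d_A$, $D=\lfloor d_A/L\rfloor$, and let $\mathcal K_A,\mathcal K_B$ be Hilbert spaces of dimension $L$ with a fixed maximally entangled state $\phi_L$ on $\mathcal K_A\otimes\mathcal K_B$. An *$L$-instrument* is a family $a=(a_k)_{k=0}^D$ of partial isometries $a_k:\mathcal H_A\to\mathcal K_A$ with pairwise orthogonal initial subspaces such that $\operatorname{rank}a_k=L$ for $k\ge1$ and $\operatorname{rank}a_0=d_A-LD$. An *$L$-merging* is a channel $\mathcal M(\rho)=\sum_{k=0}^D(a_k\otimes u_k)\,\rho\,(a_k\otimes u_k)^*$ where $(a_k)$ is an $L$-instrument and $u_k:\mathcal H_B\to\mathcal K_B\otimes\mathcal H_{B'}\otimes\mathcal H_B$ are isometries. With $F(\rho,\sigma)=\|\sqrt\rho\sqrt\sigma\|_1^2$, the merging fidelity of a state $\rho_{AB}$ is $$F_m(\rho_{AB},\mathcal M)=F\big((\mathcal M\otimes \mathrm{id})(\psi),\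 \phi_L\otimes\psi_{B'B\,\cdot}\big),$$ where $\psi$ is any purification of $\rho_{AB}$ (the value does not depend on the choice) and $\psi_{B'B\,\cdot}$ is $\psi$ with its $A$-part located on $\mathcal H_{B'}$. For an $L$-instrument $a$ and a unitary $v$ on $\mathcal H_A$ let $a(v)=(a_kv)_{k=0}^D$, and let $F_m(\rho,a(v))$ be the maximum of $F_m\big(\rho,\sum_{k=0}^D(a_kv\otimes u_k)(\cdot)(a_kv\otimes u_k)^*\big)$ over all families of isometries $(u_k)_{k=0}^D$. Let $N\ge1$, let $\rho_{AB,1},\dots,\rho_{AB,N}$ be states on $\mathcal H_A\otimes\mathcal H_B$, $\overline\rho_{AB}=\frac1N\sum_{i=1}^N\rho_{AB,i}$, let $\psi_{ABE,i}$ be a purification of $\rho_{AB,i}$ on $\mathcal H_A\otimes\mathcal H_B\otimes\mathcal H_E$ with marginals $\rho_{B,i}$ and $\rho_{E,i}$, and put $$\Delta=\frac{L}{d_A}+2\sum_{i=1}^N\sqrt{L\cdot\operatorname{rank}(\rho_{E,i})\,\|\rho_{B,i}\|_2^2}.$$ 1. For every $L$-instrument $a$, the maximum defining $F_m(\overline\rho_{AB},a(v))$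 is attained for each unitary $v$ on $\mathcal H_A$, the function $v\mapsto F_m(\overline\rho_{AB},a(v))$ is integrable with respect to the normalized Haar measure $dv$ on the unitary group of $\mathcal H_A$, and $$\int F_m(\overline\rho_{AB},a(v))\,dv\ \ge\ 1-2\Delta .$$ 2. For every $L$-instrument $a$ there is a unitary $v$ with $F_m(\overline\rho_{AB},a(v))\ge1-2\Delta$; and for each such $v$ and each family $(u_k)$ attaining the maximum in $F_m(\overline\rho_{AB},a(v))$, the $L$-merging $\mathcal M$ given by $a(v)$ and $(u_k)$ satisfies $F_m(\overline\rho_{AB},\mathcal M)\ge1-2\Delta$ and $$\min_{1\le i\le N}F_m(\rho_{AB,i},\mathcal M)\ \ge\ 1-2N\Delta .$$ In particular, an $L$-merging $\mathcal M$ with these two properties exists. -/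

import Mathlib

open Matrix MeasureTheory
open scoped MatrixOrder ComplexOrder Kronecker BigOperators

noncomputable section

namespace StateMerging

/-! Finite-dimensional Hilbert spaces are `ℂ^ι` for finite index types `ι`, tensor products are
indexed by product types, and operators are complex matrices. -/

variable {S E K₁ K₂ A B : Type*} [Fintype S] [Fintype E] [Fintype K₁] [Fintype K₂]
  [Fintype A] [Fintype B]
variable [DecidableEq S] [DecidableEq E] [DecidableEq K₁] [DecidableEq K₂]
  [DecidableEq A] [DecidableEq B]

/-- States: positive semidefinite operators of trace one. -/
def IsState {S : Type*} [Fintype S] (ρ : Matrix S S ℂ) : Prop :=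
  ρ.PosSemidef ∧ ρ.trace = 1

/-- The operator `|ψ⟩⟨ψ|`. -/
def ketbra {S : Type*} (ψ : S → ℂ) : Matrix S S ℂ := vecMulVec ψ (star ψ)

/-- Partial trace over the first tensor factor. -/
def trFst {S T : Type*} [Fintype S] (X : Matrix (S × T) (S × T) ℂ) : Matrix T T ℂ :=
  Matrix.of fun i j => ∑ s, X (s, i) (s, j)

/-- Partial trace over the second tensor factor. -/
def trSnd {S T : Type*} [Fintype T] (X : Matrix (S × T) (S × T) ℂ) : Matrix S S ℂ :=
  Matrix.of fun i j => ∑ t, X (i, t) (j, t)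

/-- `ψ`, a vector of `H_S ⊗ H_E`, is a purification of `ρ`. -/
def IsPurification {S E : Type*} [Fintype E] (ψ : S × E → ℂ) (ρ : Matrix S S ℂ) : Prop :=
  trSnd (ketbra ψ) = ρ

/-- The trace norm `‖X‖₁ = tr √(X* X)`. -/
def traceNorm {S : Type*} [Fintype S] [DecidableEq S] (X : Matrix S S ℂ) : ℝ :=
  (CFC.sqrt (Xᴴ * X)).trace.re

/-- The fidelity `F(ρ, σ) = ‖√ρ √σ‖₁²`. -/
def fidelity {S : Type*} [Fintype S] [DecidableEq S] (ρ σ : Matrix S S ℂ) : ℝ :=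
  traceNorm (CFC.sqrt ρ * CFC.sqrt σ) ^ 2

/-- The square `‖X‖₂²` of the Hilbert-Schmidt norm. -/
def hsNormSq {S T : Type*} [Fintype S] [Fintype T] (X : Matrix S T ℂ) : ℝ :=
  ∑ i, ∑ j, ‖X i j‖ ^ 2

/-- The completely positive map `X ↦ ∑ₖ Kₖ X Kₖ*`. -/
def krausMap {ι S T : Type*} [Fintype ι] [Fintype S] (K : ι → Matrix T S ℂ) :
    Matrix S S ℂ →ₗ[ℂ] Matrix T T ℂ where
  toFun X := ∑ k, K k * X * (K k)ᴴ
  map_add' X Y := by simp [Matrix.mul_add, Matrix.add_mul, Finset.sum_add_distrib]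
  map_smul' c X := by simp [Finset.smul_sum]

/-- The map `M ⊗ id_E`. -/
def ampliate {S T : Type*} (E : Type*) (M : Matrix S S ℂ →ₗ[ℂ] Matrix T T ℂ)
    (X : Matrix (S × E) (S × E) ℂ) : Matrix (T × E) (T × E) ℂ :=
  Matrix.of fun p q => M (Matrix.of fun i j => X (i, p.2) (j, q.2)) p.1 q.1

/-- `φ`, a vector of `H_{K₁} ⊗ H_{K₂}` with both factors of the same dimension, is a maximally
entangled state vector: its reduced state is maximally mixed. -/
def IsMaxEntangled {L : ℕ} (φ : Fin L × Fin L → ℂ) : Prop :=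
  trSnd (ketbra φ) = (L : ℂ)⁻¹ • (1 : Matrix (Fin L) (Fin L) ℂ)

/-- The vector `φ ⊗ ψ` of `K_A ⊗ (K_B ⊗ H_S) ⊗ H_E`. When `S = A × B`, the factor `H_S` of the
result is `H_{B'} ⊗ H_B`, where `H_{B'}` is the copy of `H_A` at the receiver. -/
def targetVec {K₁ K₂ S E : Type*} (φ : K₁ × K₂ → ℂ) (ψ : S × E → ℂ) :
    (K₁ × (K₂ × S)) × E → ℂ :=
  fun x => φ (x.1.1, x.1.2.1) * ψ (x.1.2.2, x.2)

/-- The merging fidelity `F((M ⊗ id_E)(ψ), φ ⊗ ψ)` computed with a given vector `ψ`. -/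
def mergingFidelityOf (φ : K₁ × K₂ → ℂ) (ψ : S × E → ℂ)
    (M : Matrix S S ℂ →ₗ[ℂ] Matrix (K₁ × (K₂ × S)) (K₁ × (K₂ × S)) ℂ) : ℝ :=
  fidelity (ampliate E M (ketbra ψ)) (ketbra (targetVec φ ψ))

/-- The purification of `ρ` on `H_S ⊗ H_S` given by the matrix entries of `√ρ`. -/
def canonicalPurification (ρ : Matrix S S ℂ) : S × S → ℂ := fun p => CFC.sqrt ρ p.1 p.2

/-- The merging fidelity `F_m(ρ, M)`: the fidelity above for a purification of `ρ`. By
`mergingFidelityOf_eq` below the choice of the purification does not matter. -/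
def mergingFidelity (φ : K₁ × K₂ → ℂ) (ρ : Matrix S S ℂ)
    (M : Matrix S S ℂ →ₗ[ℂ] Matrix (K₁ × (K₂ × S)) (K₁ × (K₂ × S)) ℂ) : ℝ :=
  mergingFidelityOf φ (canonicalPurification ρ) M

/-- An `L`-instrument `a₀, …, a_D` on `H_A`, `D = ⌊d_A / L⌋`: partial isometries from `H_A` to an
`L`-dimensional space with pairwise orthogonal initial subspaces (the ranges of the `aₖ*`), of
rank `L`, except for `a₀`, which has rank `d_A - L D`. -/
structure IsLInstrument (L : ℕ) (a : Fin (Fintype.card A / L + 1) → Matrix (Fin L) A ℂ) :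
    Prop where
  partialIsometry : ∀ k, a k * (a k)ᴴ * a k = a k
  rank_eq : ∀ k, k ≠ 0 → (a k).rank = L
  rank_zero : (a 0).rank = Fintype.card A - L * (Fintype.card A / L)
  orthogonal : ∀ j k, j ≠ k → a j * (a k)ᴴ = 0

/-- A family of isometries `H_B → K_B ⊗ H_{B'} ⊗ H_B`. -/
def IsIsometryFamily {ι : Type*} {L : ℕ} (u : ι → Matrix (Fin L × (A × B)) B ℂ) : Prop :=
  ∀ k, (u k)ᴴ * u k = 1

/-- The channel `ρ ↦ ∑ₖ (aₖ ⊗ uₖ) ρ (aₖ ⊗ uₖ)*`. -/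
def mergingMap {ι : Type*} [Fintype ι] {L : ℕ} (a : ι → Matrix (Fin L) A ℂ)
    (u : ι → Matrix (Fin L × (A × B)) B ℂ) :
    Matrix (A × B) (A × B) ℂ →ₗ[ℂ]
      Matrix (Fin L × (Fin L × (A × B))) (Fin L × (Fin L × (A × B))) ℂ :=
  krausMap fun k => a k ⊗ₖ u k

/-- `L`-mergings. -/
def IsLMerging (L : ℕ) (M : Matrix (A × B) (A × B) ℂ →ₗ[ℂ]
    Matrix (Fin L × (Fin L × (A × B))) (Fin L × (Fin L × (A × B))) ℂ) : Prop :=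
  ∃ (a : Fin (Fintype.card A / L + 1) → Matrix (Fin L) A ℂ)
    (u : Fin (Fintype.card A / L + 1) → Matrix (Fin L × (A × B)) B ℂ),
    IsLInstrument L a ∧ IsIsometryFamily u ∧ M = mergingMap a u

/-- The instrument `A(v)`: first the unitary `v`, then `a`. -/
def rotate {ι : Type*} {L : ℕ} (a : ι → Matrix (Fin L) A ℂ) (v : unitaryGroup A ℂ) :
    ι → Matrix (Fin L) A ℂ :=
  fun k => a k * (v : Matrix A A ℂ)

/-- The values of `F_m(ρ, ·)` on all completions of the operators `a` by isometries at `B`. -/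
def completionFidelities {ι : Type*} [Fintype ι] {L : ℕ} (φ : Fin L × Fin L → ℂ)
    (ρ : Matrix (A × B) (A × B) ℂ) (a : ι → Matrix (Fin L) A ℂ) : Set ℝ :=
  {x | ∃ u : ι → Matrix (Fin L × (A × B)) B ℂ,
    IsIsometryFamily u ∧ x = mergingFidelity φ ρ (mergingMap a u)}

/-- `F_m(ρ, 𝒜)`, the best merging fidelity of the completions of `a`. -/
def maxMergingFidelity {ι : Type*} [Fintype ι] {L : ℕ} (φ : Fin L × Fin L → ℂ)
    (ρ : Matrix (A × B) (A × B) ℂ) (a : ι → Matrix (Fin L) A ℂ) : ℝ :=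
  sSup (completionFidelities φ ρ a)

/-- The averaged state. -/
def averageState {S : Type*} {N : ℕ} (ρ : Fin N → Matrix S S ℂ) : Matrix S S ℂ :=
  (N : ℂ)⁻¹ • ∑ i, ρ i

/-- `L / d_A + 2 ∑ᵢ √(L · rank ρ_{E,i} · ‖ρ_{B,i}‖₂²)`, where `ρ_{B,i}` and `ρ_{E,i}` are the
marginals of the pure state given by `ψᵢ`. -/
def errorTerm {A B E : Type*} [Fintype A] [Fintype B] [Fintype E] {N : ℕ} (L : ℕ)
    (ψ : Fin N → (A × B) × E → ℂ) : ℝ :=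
  (L : ℝ) / Fintype.card A +
    2 * ∑ i, √((L : ℝ) * ((trFst (ketbra (ψ i))).rank : ℝ) *
      hsNormSq (trFst (trSnd (ketbra (ψ i)))))

/-! ### Normalized Haar measure on the unitary group -/

instance unitaryCompactSpace : CompactSpace (unitaryGroup A ℂ) := by
  have hK : IsCompact (Set.pi Set.univ fun _ : A => Set.pi Set.univ fun _ : A =>
      Metric.closedBall (0 : ℂ) 1) :=
    isCompact_univ_pi fun _ => isCompact_univ_pi fun _ => isCompact_closedBall _ _
  refine isCompact_iff_compactSpace.1
    (hK.of_isClosed_subset (isClosed_unitary (R := Matrix A A ℂ)) ?_)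
  intro U hU i _ j _
  simpa using entry_norm_bound_of_unitary hU i j

instance unitaryMeasurableSpace : MeasurableSpace (unitaryGroup A ℂ) := borel _

instance unitaryBorelSpace : BorelSpace (unitaryGroup A ℂ) := ⟨rfl⟩

/-- The normalized Haar measure on the unitary group of `H_A`. -/
def unitaryHaar (A : Type*) [Fintype A] [DecidableEq A] : Measure (unitaryGroup A ℂ) :=
  Measure.haarMeasure ⊤

theorem unitaryHaar_univ : unitaryHaar A Set.univ = 1 :=
  Measure.haarMeasure_self (K₀ := (⊤ : TopologicalSpace.PositiveCompacts (unitaryGroup A ℂ)))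

/-! ### The merging fidelity does not depend on the purification -/

theorem isPurification_canonicalPurification {ρ : Matrix S S ℂ} (hρ : ρ.PosSemidef) :
    IsPurification (canonicalPurification ρ) ρ := by
  have h := CFC.sqrt_mul_sqrt_self ρ hρ.nonneg
  have hs : (CFC.sqrt ρ)ᴴ = CFC.sqrt ρ := (CFC.sqrt_nonneg ρ).posSemidef.isHermitian
  unfold IsPurification
  conv_rhs => rw [← h]
  conv_rhs => rhs; rw [← hs]
  ext i j
  simp [trSnd, ketbra, canonicalPurification, vecMulVec_apply, Matrix.mul_apply]

theorem fidelity_ketbra {ρ : Matrix S S ℂ} (hρ : ρ.PosSemidef) {τ : S → ℂ}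
    (hτ : star τ ⬝ᵥ τ = 1) : fidelity ρ (ketbra τ) = (star τ ⬝ᵥ ρ *ᵥ τ).re := by
  have hP : (ketbra τ).PosSemidef := posSemidef_vecMulVec_self_star τ
  have hPP : ketbra τ * ketbra τ = ketbra τ := by
    simp [ketbra, vecMulVec_mul_vecMulVec, hτ]
  have hsq : CFC.sqrt (ketbra τ) = ketbra τ := CFC.sqrt_unique hPP hP.nonneg
  have hs : (CFC.sqrt ρ)ᴴ = CFC.sqrt ρ := (CFC.sqrt_nonneg ρ).posSemidef.isHermitian
  have hρρ := CFC.sqrt_mul_sqrt_self ρ hρ.nonneg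
  set c := star τ ⬝ᵥ ρ *ᵥ τ with hc
  have hc0 : 0 ≤ c := hρ.dotProduct_mulVec_nonneg τ
  have hcr : ((c.re : ℝ) : ℂ) = c := by
    rw [Complex.le_def] at hc0
    apply Complex.ext <;> simp
    exact hc0.2
  have hcre : 0 ≤ c.re := (Complex.le_def.1 hc0).1
  have hX : (CFC.sqrt ρ * ketbra τ)ᴴ * (CFC.sqrt ρ * ketbra τ) = c • ketbra τ := by
    rw [conjTranspose_mul, hs, hP.isHermitian.eq, Matrix.mul_assoc, ← Matrix.mul_assoc _ _ (ketbra τ),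
      hρρ]
    simp only [ketbra, mul_vecMulVec, vecMulVec_mulVec]
    rw [← hc]
    ext i j
    simp only [vecMulVec_apply, Matrix.smul_apply, Pi.smul_apply, MulOpposite.smul_eq_mul_unop,
      MulOpposite.unop_op, smul_eq_mul]
    ring
  have hsqrt : CFC.sqrt (c • ketbra τ) = (√c.re : ℂ) • ketbra τ := by
    refine CFC.sqrt_unique ?_ ?_
    · rw [smul_mul_smul_comm, hPP, ← Complex.ofReal_mul, Real.mul_self_sqrt hcre, hcr]
    · refine (hP.smul ?_).nonneg
      simp [Real.sqrt_nonneg]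
  have htr : (ketbra τ).trace = 1 := by
    rw [ketbra, trace_vecMulVec, dotProduct_comm]; exact hτ
  rw [fidelity, traceNorm, hsq, hX, hsqrt, trace_smul, htr]
  simp [Real.sq_sqrt hcre]

theorem ampliate_krausMap {ι S E T : Type*} [Fintype ι] [Fintype S]
    (K : ι → Matrix T S ℂ) (ψ : S × E → ℂ) :
    ampliate E (krausMap K) (ketbra ψ) =
      ∑ k, ketbra (fun x : T × E => ∑ s, K k x.1 s * ψ (s, x.2)) := by
  ext p q
  simp only [ampliate, krausMap, LinearMap.coe_mk, AddHom.coe_mk, Matrix.sum_apply, ketbra,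
    vecMulVec_apply, Matrix.mul_apply, conjTranspose_apply, Pi.star_apply, star_sum, star_mul',
    Finset.sum_mul, Finset.mul_sum, Matrix.of_apply]
  refine Finset.sum_congr rfl fun k _ => Finset.sum_congr rfl fun s _ =>
    Finset.sum_congr rfl fun t _ => ?_
  ring

theorem posSemidef_ampliate_krausMap {ι S E T : Type*} [Fintype ι] [Fintype S] [Fintype E]
    [Fintype T] (K : ι → Matrix T S ℂ) (ψ : S × E → ℂ) : (ampliate E (krausMap K) (ketbra ψ)).PosSemidef := by
  rw [ampliate_krausMap]
  exact posSemidef_sum _ fun k _ => posSemidef_vecMulVec_self_star _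

theorem norm_targetVec {S E K₁ K₂ : Type*} [Fintype S] [Fintype E] [Fintype K₁] [Fintype K₂]
    {φ : K₁ × K₂ → ℂ} (hφ : star φ ⬝ᵥ φ = 1) {ρ : Matrix S S ℂ}
    (hρ : IsState ρ) {ψ : S × E → ℂ} (hψ : IsPurification ψ ρ) :
    star (targetVec φ ψ) ⬝ᵥ targetVec φ ψ = 1 := by
  have h1 : ∑ s, ∑ e, ψ (s, e) * star (ψ (s, e)) = 1 := by
    rw [← hρ.2, ← hψ]; rfl
  have h2 : ∑ i, ∑ j, star (φ (i, j)) * φ (i, j) = 1 := by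
    rw [← hφ, dotProduct, Fintype.sum_prod_type]; rfl
  calc star (targetVec φ ψ) ⬝ᵥ targetVec φ ψ
      = ∑ i, ∑ j, ∑ s, ∑ e, (star (φ (i, j)) * φ (i, j)) * (ψ (s, e) * star (ψ (s, e))) := by
        simp only [dotProduct, Fintype.sum_prod_type, targetVec, Pi.star_apply, star_mul']
        refine Finset.sum_congr rfl fun _ _ => Finset.sum_congr rfl fun _ _ =>
          Finset.sum_congr rfl fun _ _ => Finset.sum_congr rfl fun _ _ => ?_
        ring
    _ = 1 := by simp only [← Finset.mul_sum, h1, mul_one, h2]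

theorem mergingFidelityOf_krausMap {ι : Type*} [Fintype ι] {φ : K₁ × K₂ → ℂ}
    (hφ : star φ ⬝ᵥ φ = 1) {ρ : Matrix S S ℂ} (hρ : IsState ρ) {ψ : S × E → ℂ}
    (hψ : IsPurification ψ ρ) (K : ι → Matrix (K₁ × (K₂ × S)) S ℂ) :
    mergingFidelityOf φ ψ (krausMap K) =
      ∑ k, ‖∑ x, ∑ s, star (φ (x.1, x.2.1)) * K k x s * ρ s x.2.2‖ ^ 2 := by
  rw [mergingFidelityOf, fidelity_ketbra (posSemidef_ampliate_krausMap K ψ)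
    (norm_targetVec hφ hρ hψ), ampliate_krausMap, Matrix.sum_mulVec, dotProduct_sum,
    Complex.re_sum]
  refine Finset.sum_congr rfl fun k _ => ?_
  set τ := targetVec φ ψ with hτ
  set χ : (K₁ × (K₂ × S)) × E → ℂ := fun x => ∑ s, K k x.1 s * ψ (s, x.2) with hχ
  have h1 : star τ ⬝ᵥ χ = ∑ x, ∑ s, star (φ (x.1, x.2.1)) * K k x s * ρ s x.2.2 := by
    rw [← hψ]
    simp only [dotProduct, Fintype.sum_prod_type (γ := ℂ) (α₂ := E), hτ, hχ, targetVec,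
      Pi.star_apply, star_mul', trSnd, ketbra, vecMulVec_apply, Finset.mul_sum, Matrix.of_apply]
    refine Finset.sum_congr rfl fun x _ => ?_
    rw [Finset.sum_comm]
    refine Finset.sum_congr rfl fun s _ => Finset.sum_congr rfl fun e _ => ?_
    ring
  have h2 : star χ ⬝ᵥ τ = star (star τ ⬝ᵥ χ) := by
    rw [star_dotProduct]
  have h3 : star τ ⬝ᵥ ketbra χ *ᵥ τ = (star τ ⬝ᵥ χ) * star (star τ ⬝ᵥ χ) := by
    rw [← h2, ketbra, vecMulVec_mulVec, dotProduct_smul]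
    simp
  rw [h3, h1, Complex.star_def, Complex.mul_conj, Complex.normSq_eq_norm_sq, Complex.ofReal_re]

/-- The merging fidelity of a completely positive map can be computed with any purification. -/
theorem mergingFidelityOf_eq {ι : Type*} [Fintype ι] {φ : K₁ × K₂ → ℂ} (hφ : star φ ⬝ᵥ φ = 1)
    {ρ : Matrix S S ℂ} (hρ : IsState ρ) {ψ : S × E → ℂ} (hψ : IsPurification ψ ρ)
    (K : ι → Matrix (K₁ × (K₂ × S)) S ℂ) :
    mergingFidelityOf φ ψ (krausMap K) = mergingFidelity φ ρ (krausMap K) := by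
  rw [mergingFidelity, mergingFidelityOf_krausMap hφ hρ hψ K,
    mergingFidelityOf_krausMap hφ hρ (isPurification_canonicalPurification hρ.1) K]

end StateMerging

end

open StateMerging

/-!
The merging fidelity of `ρ = Ψ Ψ*` under Kraus operators `aₖ ⊗ uₖ` is `∑ₖ |Tₖ(ρ)|²`, where the
amplitude `Tₖ` (`overlap`) is linear in `ρ`. Everything else follows from estimates of these
amplitudes.

*Decoupling.* Write `P` for the vector `(aₖ ⊗ 1) Ψ` and `Q` for the target vector, both as matrices
whose rows belong to sender and reference. Then `Tₖ = tr (Q* P uₖᵀ)`, and `P P*`, `Q Q*` are the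
states of sender and reference. If `P P* - c Q Q* = H₊ - H₋` is a Jordan decomposition and
`M = P P* + H₋ = c Q Q* + H₊`, then `W = √c P* M⁻¹ Q` is a contraction, and its overlap
`√c tr (Q* P W)` is `½ (tr P P* + c tr Q Q* - tr (H₊ + H₋))`, because `H₊ H₋ = 0`
(`exists_contraction_re_trace_ge`; `M` is regularized to make it invertible). A contraction can be
replaced by an isometry through the singular value decomposition
(`exists_isometry_re_trace_ge`). With `s² ≥ 2 √c s - c` this gives
`max |Tₖ|² ≥ tr P P* - ‖P P* - c Q Q*‖₁` (`exists_isometry_overlap_sq_ge`).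

*Random rotation.* With `c = L / d`, the operator `P P* - c Q Q*` consists of the blocks
`aₖ v X₀ v* aₖ*` with `X₀` traceless. Left invariance of the Haar measure, applied to unitaries that
exchange basis vectors or rotate a pair of them by `45°`, shows that each matrix entry of `v X₀ v*`
in an orthonormal basis has second moment at most `16 ‖X₀‖₂² / d²` (`haarMoment_orthonormal_le`,
`haarMoment_self_le`); no integration formula for the unitary group is used. Hence the
Hilbert-Schmidt norm of a block is of order `(L / d) ‖X₀‖₂` on average
(`integral_hsNormSq_compression_le`).

*Averaged states.* The averaged state is purified with a reference system that is the direct sum of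
minimal reference systems for the `ρᵢ`, so that the ranks enter as dimensions. The trace norm is
compared with a Hilbert-Schmidt norm weighted by `(L rank ρᵢ)^{1/2}` on the `i`-th summand
(`re_trace_mul_unitary_le`); the sum over all pairs of summands then factors into the square of
`∑ᵢ (L rank ρ_{E,i} ‖ρ_{B,i}‖₂²)^{1/2}` (`exists_purification_averageState`). Summing over the
`⌊d / L⌋` outcomes of rank `L` yields the bound on the integral, since these have total probability
at least `1 - L / d` on average. The maximum is attained, and depends continuously on `v`, since the
isometries form a compact set.

*Individual states.* By linearity of `Tₖ` the fidelity is convex in the state, and it never exceeds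
one, so that an average fidelity of at least `1 - δ` forces `1 - N δ` for every `ρᵢ`
(`le_mergingFidelity_of_averageState`).
-/

namespace StateMerging

/-! ### Singular values, isometries and the positive part of a Hermitian matrix -/

section LinearAlgebra

variable {I J B : Type*} [Fintype I] [DecidableEq I] [Fintype J] [DecidableEq J]
  [Fintype B] [DecidableEq B]

/-- Orthonormal columns, prescribed on a set of positions, extend to a unitary matrix. -/
theorem exists_unitary_extending {s : Set J} {c : J → J → ℂ}
    (hc : ∀ i ∈ s, ∀ j ∈ s, star (c i) ⬝ᵥ c j = if i = j then 1 else 0) :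
    ∃ U : Matrix J J ℂ, Uᴴ * U = 1 ∧ ∀ i ∈ s, ∀ a, U a i = c i a := by
  have hv : Orthonormal ℂ (s.domRestrict fun i => (WithLp.toLp 2 (c i) : EuclideanSpace ℂ J)) := by
    rw [orthonormal_iff_ite]
    rintro ⟨i, hi⟩ ⟨j, hj⟩
    simpa [EuclideanSpace.inner_eq_star_dotProduct, dotProduct_comm, Subtype.ext_iff]
      using hc i hi j hj
  obtain ⟨b, hb⟩ := hv.exists_orthonormalBasis_extension_of_card_eq (by simp)
  refine ⟨of fun a i => b i a, ?_, fun i hi a => by simp [hb i hi]⟩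
  ext i j
  have := orthonormal_iff_ite.1 b.orthonormal i j
  rw [EuclideanSpace.inner_eq_star_dotProduct, dotProduct_comm] at this
  simpa [Matrix.mul_apply, dotProduct, Matrix.one_apply] using this

theorem exists_diagonalization {H : Matrix J J ℂ} (hH : H.IsHermitian) :
    ∃ V : Matrix J J ℂ, Vᴴ * V = 1 ∧ V * Vᴴ = 1 ∧
      H = V * diagonal (fun i => (hH.eigenvalues i : ℂ)) * Vᴴ := by
  refine ⟨hH.eigenvectorUnitary, ?_, ?_, ?_⟩
  · simpa [star_eq_conjTranspose] using Unitary.coe_star_mul_self hH.eigenvectorUnitary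
  · simpa [star_eq_conjTranspose] using Unitary.coe_mul_star_self hH.eigenvectorUnitary
  · conv_lhs => rw [hH.spectral_theorem]
    rfl

omit [DecidableEq I] [Fintype J] [DecidableEq J] in
theorem dotProduct_col {C D : Matrix I J ℂ} (i j : J) :
    star (fun a => C a i) ⬝ᵥ (fun a => D a j) = (Cᴴ * D) i j := by
  simp [Matrix.mul_apply, dotProduct]

/-- Singular value decomposition of a square matrix. -/
theorem exists_singular_value_decomposition (Z : Matrix J J ℂ) :
    ∃ (U V : Matrix J J ℂ) (σ : J → ℝ), Uᴴ * U = 1 ∧ Vᴴ * V = 1 ∧ (∀ i, 0 ≤ σ i) ∧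
      Z = U * diagonal (fun i => (σ i : ℂ)) * Vᴴ := by
  have hP := posSemidef_conjTranspose_mul_self Z
  obtain ⟨V, hV, hV', hZ⟩ := exists_diagonalization hP.isHermitian
  set lam := hP.isHermitian.eigenvalues with hlam
  have hlam0 : ∀ i, 0 ≤ lam i := hP.eigenvalues_nonneg
  have hC : (Z * V)ᴴ * (Z * V) = diagonal (fun i => (lam i : ℂ)) := by
    rw [conjTranspose_mul, Matrix.mul_assoc, ← Matrix.mul_assoc Zᴴ, hZ]
    simp only [Matrix.mul_assoc, hV, Matrix.mul_one]
    rw [← Matrix.mul_assoc, hV, Matrix.one_mul]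
  have hCij : ∀ i j, star (fun a => (Z * V) a i) ⬝ᵥ (fun a => (Z * V) a j) =
      if i = j then (lam i : ℂ) else 0 := by
    intro i j
    rw [dotProduct_col, hC, diagonal_apply]
  -- the columns of `Z V` are orthogonal with norms `√λᵢ`; normalize the nonzero ones and extend
  obtain ⟨U, hU, hUc⟩ := exists_unitary_extending (s := {i | lam i ≠ 0})
    (c := fun i a => ((√(lam i) : ℝ) : ℂ)⁻¹ * (Z * V) a i) (by
      intro i hi j hj
      have h1 : star (fun a => ((√(lam i) : ℝ) : ℂ)⁻¹ * (Z * V) a i) ⬝ᵥ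
          (fun a => ((√(lam j) : ℝ) : ℂ)⁻¹ * (Z * V) a j) =
          ((√(lam i) : ℝ) : ℂ)⁻¹ * ((√(lam j) : ℝ) : ℂ)⁻¹ *
            (star (fun a => (Z * V) a i) ⬝ᵥ (fun a => (Z * V) a j)) := by
        simp only [dotProduct, Pi.star_apply, star_mul', star_inv₀, Complex.star_def,
          Complex.conj_ofReal, Finset.mul_sum]
        exact Finset.sum_congr rfl fun _ _ => by ring
      rw [h1, hCij]
      split_ifs with hij
      · subst hij
        have h0 : ((√(lam i) : ℝ) : ℂ) ≠ 0 := by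
          simpa [Real.sqrt_eq_zero (hlam0 i)] using hi
        have h2 : (lam i : ℂ) = ((√(lam i) : ℝ) : ℂ) * ((√(lam i) : ℝ) : ℂ) := by
          rw [← Complex.ofReal_mul, Real.mul_self_sqrt (hlam0 i)]
        rw [h2]; field_simp
      · simp)
  refine ⟨U, V, fun i => √(lam i), hU, hV, fun i => Real.sqrt_nonneg _, ?_⟩
  have key : Z * V = U * diagonal (fun i => ((√(lam i) : ℝ) : ℂ)) := by
    ext a i
    rw [mul_diagonal]
    by_cases hi : lam i = 0
    · have := hCij i i
      rw [if_pos rfl, hi, Complex.ofReal_zero, dotProduct_star_self_eq_zero] at this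
      have h3 := congrFun this a
      simp only [Pi.zero_apply] at h3
      rw [h3, hi]; simp
    · rw [hUc i hi]
      have h0 : ((√(lam i) : ℝ) : ℂ) ≠ 0 := by
        simpa [Real.sqrt_eq_zero (hlam0 i)] using hi
      field_simp
  rw [← key, Matrix.mul_assoc, hV', Matrix.mul_one]

theorem re_diag_le_one_of_contraction {Y : Matrix J J ℂ} (h : (1 - Y * Yᴴ).PosSemidef) (i : J) :
    (Y i i).re ≤ 1 := by
  have h1 : 0 ≤ (1 - Y * Yᴴ) i i := h.diag_nonneg
  have h2 : (Y * Yᴴ) i i = ((∑ j, ‖Y i j‖ ^ 2 : ℝ) : ℂ) := by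
    simp [Matrix.mul_apply, Complex.mul_conj, Complex.normSq_eq_norm_sq]
  rw [Matrix.sub_apply, h2, one_apply_eq, ← Complex.ofReal_one, ← Complex.ofReal_sub,
    Complex.zero_le_real] at h1
  have h3 : ‖Y i i‖ ^ 2 ≤ ∑ j, ‖Y i j‖ ^ 2 :=
    Finset.single_le_sum (f := fun j => ‖Y i j‖ ^ 2) (fun _ _ => by positivity) (Finset.mem_univ i)
  have h4 := Complex.re_le_norm (Y i i)
  nlinarith [norm_nonneg (Y i i)]

/-- A linear functional is at most as large on a contraction as on some unitary. -/
theorem exists_unitary_re_trace_ge (Y : Matrix J J ℂ) {W : Matrix J J ℂ}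
    (hW : (1 - W * Wᴴ).PosSemidef) :
    ∃ U : Matrix J J ℂ, Uᴴ * U = 1 ∧ (Y * W).trace.re ≤ (Y * U).trace.re := by
  obtain ⟨U, V, σ, hU, hV, hσ, rfl⟩ := exists_singular_value_decomposition Y
  have hU' : U * Uᴴ = 1 := mul_eq_one_comm.1 hU
  have hV' : V * Vᴴ = 1 := mul_eq_one_comm.1 hV
  refine ⟨V * Uᴴ, ?_, ?_⟩
  · rw [conjTranspose_mul, conjTranspose_conjTranspose, Matrix.mul_assoc, ← Matrix.mul_assoc Vᴴ,
      hV, Matrix.one_mul, hU']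
  have h1 : (U * diagonal (fun i => (σ i : ℂ)) * Vᴴ * (V * Uᴴ)).trace =
      (diagonal (fun i => (σ i : ℂ))).trace := by
    rw [Matrix.mul_assoc _ Vᴴ, ← Matrix.mul_assoc Vᴴ, hV, Matrix.one_mul, Matrix.mul_assoc,
      trace_mul_comm, Matrix.mul_assoc, hU, Matrix.mul_one]
  have h2 : (U * diagonal (fun i => (σ i : ℂ)) * Vᴴ * W).trace =
      (diagonal (fun i => (σ i : ℂ)) * (Vᴴ * W * U)).trace := by
    rw [Matrix.mul_assoc, Matrix.mul_assoc, trace_mul_comm, Matrix.mul_assoc]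
  have h3 : (1 - (Vᴴ * W * U) * (Vᴴ * W * U)ᴴ).PosSemidef := by
    have := hW.conjTranspose_mul_mul_same V
    convert this using 1
    simp only [conjTranspose_mul, conjTranspose_conjTranspose, Matrix.mul_sub, Matrix.sub_mul,
      Matrix.mul_one, hV]
    congr 1
    simp only [Matrix.mul_assoc]
    rw [← Matrix.mul_assoc U, hU', Matrix.one_mul]
  rw [h1, h2, trace, trace, Complex.re_sum, Complex.re_sum]
  refine Finset.sum_le_sum fun i _ => ?_
  simp only [diag_apply, diagonal_mul, diagonal_apply_eq, Complex.re_ofReal_mul,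
    Complex.ofReal_re]
  exact mul_le_of_le_one_right (hσ i) (re_diag_le_one_of_contraction h3 i)

/-- A linear functional is at most as large on a contraction as on some isometry; the isometry
enters through its transpose. -/
theorem exists_isometry_re_trace_ge (e : B ↪ J) (Y : Matrix J B ℂ) {W : Matrix B J ℂ}
    (hW : (1 - W * Wᴴ).PosSemidef) :
    ∃ u : Matrix J B ℂ, uᴴ * u = 1 ∧ (Y * W).trace.re ≤ (Y * uᵀ).trace.re := by
  -- pad `W` to a square matrix with the coordinate isometry `F` given by `e`
  set F : Matrix J B ℂ := of fun j b => if j = e b then 1 else 0 with hF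
  have hFF : Fᴴ * F = 1 := by
    ext b b'
    simp [hF, Matrix.mul_apply, Matrix.one_apply, eq_comm]
  have hFW : (1 - (F * W) * (F * W)ᴴ).PosSemidef := by
    have h1 := hW.mul_mul_conjTranspose_same F
    have h2 : (1 - F * Fᴴ).PosSemidef := by
      have h3 : (1 - F * Fᴴ) = (1 - F * Fᴴ)ᴴ * (1 - F * Fᴴ) := by
        simp only [conjTranspose_sub, conjTranspose_one, conjTranspose_mul,
          conjTranspose_conjTranspose, Matrix.mul_sub, Matrix.sub_mul, Matrix.mul_one,
          Matrix.one_mul]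
        rw [Matrix.mul_assoc F, ← Matrix.mul_assoc Fᴴ F, hFF, Matrix.one_mul]
        simp
      rw [h3]
      exact posSemidef_conjTranspose_mul_self _
    convert h2.add h1 using 1
    simp only [conjTranspose_mul, Matrix.mul_sub, Matrix.sub_mul, Matrix.mul_one]
    simp only [Matrix.mul_assoc]
    abel
  obtain ⟨U, hU, hle⟩ := exists_unitary_re_trace_ge (Y * Fᴴ) hFW
  have hU' : U * Uᴴ = 1 := mul_eq_one_comm.1 hU
  refine ⟨(Fᴴ * U)ᵀ, ?_, ?_⟩
  · have h1 : (Fᴴ * U) * (Fᴴ * U)ᴴ = 1 := by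
      rw [conjTranspose_mul, conjTranspose_conjTranspose, Matrix.mul_assoc, ← Matrix.mul_assoc U,
        hU', Matrix.one_mul, hFF]
    rw [← transpose_transpose (1 : Matrix B B ℂ), transpose_one, ← h1, transpose_mul _ (_ᴴ)]
    rfl
  · rw [Matrix.mul_assoc, ← Matrix.mul_assoc Fᴴ, hFF, Matrix.one_mul, Matrix.mul_assoc] at hle
    simpa using hle

/-- Jordan decomposition `H = H₊ - H₋` of a Hermitian matrix, together with a unitary `U` (the sign
of `H`) such that `H₊ + H₋ = H U`. -/
theorem exists_jordan_decomposition {H : Matrix J J ℂ} (hH : H.IsHermitian) :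
    ∃ P M U : Matrix J J ℂ, P.PosSemidef ∧ M.PosSemidef ∧ U * Uᴴ = 1 ∧ H = P - M ∧ P * M = 0 ∧
      P + M = H * U := by
  obtain ⟨V, hV, hV', hHV⟩ := exists_diagonalization hH
  set lam := hH.eigenvalues with hlam
  set f : (J → ℝ) → Matrix J J ℂ := fun s => V * diagonal (fun i => (s i : ℂ)) * Vᴴ with hf
  have hmul : ∀ s t, f s * f t = f (s * t) := by
    intro s t
    simp only [hf, Matrix.mul_assoc]
    rw [← Matrix.mul_assoc Vᴴ, hV, Matrix.one_mul, ← Matrix.mul_assoc (diagonal _),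
      diagonal_mul_diagonal]
    simp
  have hpos : ∀ s, (∀ i, 0 ≤ s i) → (f s).PosSemidef := by
    intro s hs
    refine PosSemidef.mul_mul_conjTranspose_same (PosSemidef.diagonal fun i => ?_) V
    simpa using hs i
  have hconj : ∀ s, (f s)ᴴ = f s := by
    intro s
    simp only [hf, conjTranspose_mul, conjTranspose_conjTranspose, diagonal_conjTranspose,
      Matrix.mul_assoc]
    congr 3
    ext i; simp
  have hadd : ∀ s t, f s + f t = f (s + t) := by
    intro s t
    simp only [hf, ← Matrix.add_mul, ← Matrix.mul_add, diagonal_add]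
    simp
  have hsub : ∀ s t, f s - f t = f (s - t) := by
    intro s t
    simp only [hf, ← Matrix.sub_mul, ← Matrix.mul_sub, diagonal_sub]
    simp
  have hone : f 1 = 1 := by simp [hf, hV']
  have hzero : f 0 = 0 := by simp [hf]
  have hHf : H = f lam := hHV
  refine ⟨f fun i => max (lam i) 0, f fun i => max (-lam i) 0, f fun i => if 0 ≤ lam i then 1 else -1,
    hpos _ fun i => le_max_right _ _, hpos _ fun i => le_max_right _ _, ?_, ?_, ?_, ?_⟩
  · rw [hconj, hmul, ← hone]
    congr 1; ext i; simp only [Pi.mul_apply, Pi.one_apply]; split_ifs <;> norm_num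
  · rw [hsub, hHf]
    congr 1; ext i; simp only [Pi.sub_apply]
    exact (posPart_sub_negPart (lam i)).symm
  · rw [hmul, ← hzero]
    congr 1; ext i; simp only [Pi.mul_apply, Pi.zero_apply]
    rcases le_total 0 (lam i) with h | h
    · rw [max_eq_right (neg_nonpos.2 h), mul_zero]
    · rw [max_eq_right h, zero_mul]
  · rw [hadd, hHf, hmul]
    congr 1; ext i; simp only [Pi.mul_apply, Pi.add_apply]
    split_ifs with h
    · rw [max_eq_left h, max_eq_right (neg_nonpos.2 h)]; ring
    · rw [max_eq_right (not_le.1 h).le, max_eq_left (neg_nonneg.2 (not_le.1 h).le)]; ring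

end LinearAlgebra

/-! ### Overlap of purifications and the trace norm -/

section Overlap

variable {I J B : Type*} [Fintype I] [DecidableEq I] [Fintype J] [DecidableEq J]
  [Fintype B] [DecidableEq B]

/-- Schur complements: if `M` dominates `P P*`, then `P* M⁻¹ P ≤ 1`. -/
theorem posSemidef_one_sub_of_posSemidef_sub {M : Matrix I I ℂ} (hM : M.PosDef)
    {P : Matrix I B ℂ} (h : (M - P * Pᴴ).PosSemidef) : (1 - Pᴴ * M⁻¹ * P).PosSemidef := by
  have : Invertible M := hM.isUnit.invertible
  have : Invertible (1 : Matrix B B ℂ) := invertibleOne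
  rw [← PosDef.fromBlocks₁₁ P 1 hM, PosDef.fromBlocks₂₂ M P PosDef.one]
  simpa using h

omit [DecidableEq J] in
/-- If `M` dominates both `P P*` and `Q Q*`, then `P* M⁻¹ Q` is a contraction. -/
theorem posSemidef_one_sub_interpolation {M : Matrix I I ℂ} (hM : M.PosDef)
    {P : Matrix I B ℂ} {Q : Matrix I J ℂ} (hP : (M - P * Pᴴ).PosSemidef)
    (hQ : (M - Q * Qᴴ).PosSemidef) :
    (1 - (Pᴴ * M⁻¹ * Q) * (Pᴴ * M⁻¹ * Q)ᴴ).PosSemidef := by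
  have hinv : M * M⁻¹ = 1 := mul_nonsing_inv _ ((isUnit_iff_isUnit_det _).1 hM.isUnit)
  have hinv' : (M⁻¹)ᴴ = M⁻¹ := hM.inv.isHermitian
  convert (posSemidef_one_sub_of_posSemidef_sub hM hP).add
    (hQ.conjTranspose_mul_mul_same (M⁻¹ * P)) using 1
  simp only [conjTranspose_mul, conjTranspose_conjTranspose, hinv', Matrix.mul_sub,
    Matrix.sub_mul, Matrix.mul_assoc]
  rw [← Matrix.mul_assoc M, hinv, Matrix.one_mul]
  abel

theorem re_trace_mul_nonneg {X Y : Matrix I I ℂ} (hX : X.PosSemidef) (hY : Y.PosSemidef) :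
    0 ≤ (X * Y).trace.re := by
  have hs : (CFC.sqrt X)ᴴ = CFC.sqrt X := (CFC.sqrt_nonneg X).posSemidef.isHermitian
  have h := hY.mul_mul_conjTranspose_same (CFC.sqrt X)
  have h2 : (X * Y).trace = (CFC.sqrt X * Y * (CFC.sqrt X)ᴴ).trace := by
    rw [hs, trace_mul_comm _ (CFC.sqrt X), ← Matrix.mul_assoc, CFC.sqrt_mul_sqrt_self X hX.nonneg]
  rw [h2]
  exact (Complex.le_def.1 h.trace_nonneg).1

omit [DecidableEq J] in
/-- Two matrices `P`, `Q` have, after a suitable contraction `W` on the auxiliary system, an overlap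
of at least `½ (tr P P* + tr Q Q* - ‖P P* - Q Q*‖₁)`, up to an arbitrarily small error. The trace
norm is written through the Jordan decomposition `P P* - Q Q* = Hp - Hm`. -/
theorem exists_contraction_re_trace_ge (P : Matrix I B ℂ) (Q : Matrix I J ℂ)
    {Hp Hm : Matrix I I ℂ} (hp : Hp.PosSemidef) (hm : Hm.PosSemidef)
    (hH : P * Pᴴ - Q * Qᴴ = Hp - Hm) (hpm : Hp * Hm = 0) {ε : ℝ} (hε : 0 < ε) :
    ∃ W : Matrix B J ℂ, (1 - W * Wᴴ).PosSemidef ∧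
      ((P * Pᴴ).trace.re + (Q * Qᴴ).trace.re - (Hp + Hm).trace.re) / 2 - ε * Fintype.card I ≤
        (Qᴴ * P * W).trace.re := by
  have hε1 : ((ε : ℂ) • (1 : Matrix I I ℂ)).PosDef := PosDef.one.smul (by simpa using hε)
  set M := P * Pᴴ + (Hm + (ε : ℂ) • (1 : Matrix I I ℂ)) with hM
  have hM' : M = Q * Qᴴ + (Hp + (ε : ℂ) • (1 : Matrix I I ℂ)) := by
    rw [hM, ← sub_eq_zero]
    have := sub_eq_zero.2 hH
    rw [← this]; abel
  have hMpos : M.PosDef :=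
    PosDef.posSemidef_add (posSemidef_self_mul_conjTranspose P) (hε1.posSemidef_add hm)
  have hinv : M * M⁻¹ = 1 := mul_nonsing_inv _ ((isUnit_iff_isUnit_det _).1 hMpos.isUnit)
  have hinv' : M⁻¹ * M = 1 := nonsing_inv_mul _ ((isUnit_iff_isUnit_det _).1 hMpos.isUnit)
  have hS : P * Pᴴ = M - (Hm + (ε : ℂ) • (1 : Matrix I I ℂ)) := by rw [hM]; abel
  have hR : Q * Qᴴ = M - (Hp + (ε : ℂ) • (1 : Matrix I I ℂ)) := by rw [hM']; abel
  refine ⟨Pᴴ * M⁻¹ * Q, posSemidef_one_sub_interpolation hMpos ?_ ?_, ?_⟩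
  · rw [hM, add_sub_cancel_left]
    exact hm.add hε1.posSemidef
  · rw [hM', add_sub_cancel_left]
    exact hp.add hε1.posSemidef
  have h1 : (Qᴴ * P * (Pᴴ * M⁻¹ * Q)).trace = ((P * Pᴴ) * M⁻¹ * (Q * Qᴴ)).trace := by
    rw [Matrix.mul_assoc, trace_mul_comm]
    simp only [Matrix.mul_assoc]
  have h2 : (P * Pᴴ) * M⁻¹ * (Q * Qᴴ) = M - (Hm + (ε : ℂ) • (1 : Matrix I I ℂ)) -
      (Hp + (ε : ℂ) • (1 : Matrix I I ℂ)) +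
      (Hm + (ε : ℂ) • (1 : Matrix I I ℂ)) * M⁻¹ * (Hp + (ε : ℂ) • (1 : Matrix I I ℂ)) := by
    rw [hS, hR, Matrix.sub_mul _ _ M⁻¹, hinv, Matrix.mul_sub, Matrix.sub_mul, Matrix.sub_mul,
      Matrix.one_mul, Matrix.one_mul, Matrix.mul_assoc _ _ M, hinv', Matrix.mul_one]
    abel
  -- the cross term is of order `ε` because `Hp * Hm = 0`, and it is nonnegative
  have h3 : 0 ≤ ((Hm + (ε : ℂ) • (1 : Matrix I I ℂ)) * M⁻¹ *
      (Hp + (ε : ℂ) • (1 : Matrix I I ℂ))).trace.re := by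
    rw [trace_mul_comm, ← Matrix.mul_assoc]
    refine re_trace_mul_nonneg ?_ hMpos.inv.posSemidef
    have : (Hp + (ε : ℂ) • (1 : Matrix I I ℂ)) * (Hm + (ε : ℂ) • (1 : Matrix I I ℂ)) =
        (ε : ℂ) • (Hp + Hm + (ε : ℂ) • (1 : Matrix I I ℂ)) := by
      simp only [Matrix.add_mul, Matrix.mul_add, hpm, Matrix.smul_mul, Matrix.mul_smul,
        Matrix.one_mul, Matrix.mul_one, smul_add, zero_add]
      abel
    rw [this]
    exact ((hp.add hm).add hε1.posSemidef).smul (by simpa using hε.le)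
  have h4 : M.trace.re = (P * Pᴴ).trace.re + (Hm.trace.re + ε * Fintype.card I) := by
    simp [hM, trace_add, trace_smul]
  have h5 : M.trace.re = (Q * Qᴴ).trace.re + (Hp.trace.re + ε * Fintype.card I) := by
    simp [hM', trace_add, trace_smul]
  rw [h1, h2, trace_add (_ - _), trace_sub, trace_sub]
  simp only [trace_add, trace_smul, Complex.add_re, Complex.sub_re, trace_one, smul_eq_mul,
    Complex.re_ofReal_mul, Complex.natCast_re] at h3 ⊢
  linarith

/-- Weighted comparison of the trace norm with the Hilbert-Schmidt norm: for positive weights `g`,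
`|tr (H U)| ≤ (∑ g²)^{1/2} ‖g^{-1/2} H g^{-1/2}‖₂`. -/
theorem re_trace_mul_unitary_le (H : Matrix I I ℂ) {U : Matrix I I ℂ} (hU : U * Uᴴ = 1)
    {g : I → ℝ} (hg : ∀ p, 0 < g p) :
    (H * U).trace.re ≤ √(∑ p, g p ^ 2) * √(∑ p, ∑ q, ‖H p q‖ ^ 2 / (g p * g q)) := by
  have hU' : Uᴴ * U = 1 := mul_eq_one_comm.1 hU
  have hrow : ∀ q, ∑ p, ‖U q p‖ ^ 2 = 1 := by
    intro q
    have := congrFun (congrFun hU q) q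
    simp only [Matrix.mul_apply, conjTranspose_apply, Complex.star_def, Complex.mul_conj,
      Complex.normSq_eq_norm_sq, one_apply_eq] at this
    exact_mod_cast this
  have hcol : ∀ p, ∑ q, ‖U q p‖ ^ 2 = 1 := by
    intro p
    have := congrFun (congrFun hU' p) p
    simp only [Matrix.mul_apply, conjTranspose_apply, Complex.star_def, mul_comm _ (U _ _),
      Complex.mul_conj, Complex.normSq_eq_norm_sq, one_apply_eq] at this
    exact_mod_cast this
  have hW : ∑ x : I × I, (g x.1 * g x.2) * ‖U x.2 x.1‖ ^ 2 ≤ ∑ p, g p ^ 2 := by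
    rw [Fintype.sum_prod_type]
    calc ∑ p, ∑ q, (g p * g q) * ‖U q p‖ ^ 2
        ≤ ∑ p, ∑ q, (g p ^ 2 * ‖U q p‖ ^ 2 / 2 + g q ^ 2 * ‖U q p‖ ^ 2 / 2) := by
          refine Finset.sum_le_sum fun p _ => Finset.sum_le_sum fun q _ => ?_
          nlinarith [mul_nonneg (sq_nonneg (g p - g q)) (sq_nonneg ‖U q p‖)]
      _ = ∑ p, g p ^ 2 := by
          simp only [Finset.sum_add_distrib]
          rw [Finset.sum_comm (f := fun p q => g q ^ 2 * ‖U q p‖ ^ 2 / 2)]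
          simp only [← Finset.sum_div, ← Finset.mul_sum, hrow, hcol, mul_one]
          ring
  have hsq : ∀ x : I × I, √(g x.1 * g x.2) ≠ 0 := fun x =>
    (Real.sqrt_pos.2 (mul_pos (hg _) (hg _))).ne'
  calc (H * U).trace.re ≤ ‖(H * U).trace‖ := Complex.re_le_norm _
    _ ≤ ∑ p, ∑ q, ‖H p q * U q p‖ := by
        simp only [trace, diag_apply, Matrix.mul_apply]
        exact (norm_sum_le _ _).trans (Finset.sum_le_sum fun _ _ => norm_sum_le _ _)
    _ = ∑ x : I × I, (√(g x.1 * g x.2) * ‖U x.2 x.1‖) * (‖H x.1 x.2‖ / √(g x.1 * g x.2)) := by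
        rw [Fintype.sum_prod_type]
        refine Finset.sum_congr rfl fun p _ => Finset.sum_congr rfl fun q _ => ?_
        have := hsq (p, q)
        rw [norm_mul]
        field_simp
    _ ≤ √(∑ x : I × I, (√(g x.1 * g x.2) * ‖U x.2 x.1‖) ^ 2) *
          √(∑ x : I × I, (‖H x.1 x.2‖ / √(g x.1 * g x.2)) ^ 2) :=
        Real.sum_mul_le_sqrt_mul_sqrt _ _ _
    _ ≤ _ := by
        simp only [mul_pow, div_pow, Real.sq_sqrt (mul_pos (hg _) (hg _)).le]
        rw [Fintype.sum_prod_type (f := fun x : I × I => ‖H x.1 x.2‖ ^ 2 / (g x.1 * g x.2))]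
        gcongr

end Overlap

/-! ### Second moments of the Haar measure on the unitary group -/

section Haar

variable {A : Type*} [Fintype A] [DecidableEq A]

instance isHaarMeasure_unitaryHaar : (unitaryHaar A).IsHaarMeasure :=
  inferInstanceAs (Measure.haarMeasure ⊤).IsHaarMeasure

instance isProbabilityMeasure_unitaryHaar : IsProbabilityMeasure (unitaryHaar A) :=
  ⟨unitaryHaar_univ⟩

theorem integrable_unitaryHaar {f : unitaryGroup A ℂ → ℝ} (hf : Continuous f) :
    Integrable f (unitaryHaar A) :=
  hf.integrable_of_hasCompactSupport (HasCompactSupport.of_compactSpace f)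

/-- The rotated operator `v X v*`. -/
def conjBy (v : unitaryGroup A ℂ) (X : Matrix A A ℂ) : Matrix A A ℂ :=
  (v : Matrix A A ℂ) * X * (v : Matrix A A ℂ)ᴴ

theorem continuous_conjBy (X : Matrix A A ℂ) : Continuous fun v => conjBy v X := by
  unfold conjBy
  fun_prop

theorem coe_conjTranspose_mul_self (v : unitaryGroup A ℂ) :
    (v : Matrix A A ℂ)ᴴ * (v : Matrix A A ℂ) = 1 :=
  Unitary.coe_star_mul_self v

theorem coe_mul_conjTranspose_self (v : unitaryGroup A ℂ) :
    (v : Matrix A A ℂ) * (v : Matrix A A ℂ)ᴴ = 1 :=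
  Unitary.coe_mul_star_self v

theorem trace_conjBy (v : unitaryGroup A ℂ) (X : Matrix A A ℂ) : (conjBy v X).trace = X.trace := by
  rw [conjBy, trace_mul_comm, ← Matrix.mul_assoc, coe_conjTranspose_mul_self, Matrix.one_mul]

theorem conjBy_sub_smul_one (v : unitaryGroup A ℂ) (X : Matrix A A ℂ) (c : ℂ) :
    conjBy v (X - c • 1) = conjBy v X - c • 1 := by
  simp [conjBy, Matrix.mul_sub, Matrix.sub_mul, coe_mul_conjTranspose_self]

theorem hsNormSq_eq_trace {S T : Type*} [Fintype S] [Fintype T] (X : Matrix S T ℂ) :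
    hsNormSq X = (X * Xᴴ).trace.re := by
  simp only [hsNormSq, trace, diag_apply, Matrix.mul_apply, conjTranspose_apply, Complex.star_def,
    Complex.mul_conj, Complex.normSq_eq_norm_sq, Complex.re_sum, Complex.ofReal_re]

theorem hsNormSq_nonneg {S T : Type*} [Fintype S] [Fintype T] (X : Matrix S T ℂ) :
    0 ≤ hsNormSq X := by
  unfold hsNormSq; positivity

theorem hsNormSq_conjBy (v : unitaryGroup A ℂ) (X : Matrix A A ℂ) :
    hsNormSq (conjBy v X) = hsNormSq X := by
  have h : conjBy v X * (conjBy v X)ᴴ = conjBy v (X * Xᴴ) := by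
    simp only [conjBy, conjTranspose_mul, conjTranspose_conjTranspose, Matrix.mul_assoc]
    rw [← Matrix.mul_assoc (v : Matrix A A ℂ)ᴴ, coe_conjTranspose_mul_self, Matrix.one_mul]
  rw [hsNormSq_eq_trace, h, trace_conjBy, hsNormSq_eq_trace]

/-- The sesquilinear form `⟨w, Y w'⟩`. -/
def form (Y : Matrix A A ℂ) (w w' : A → ℂ) : ℂ := star w ⬝ᵥ Y *ᵥ w'

theorem form_single (Y : Matrix A A ℂ) (i j : A) :
    form Y (Pi.single i 1) (Pi.single j 1) = Y i j := by
  simp [form, Pi.star_single]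

theorem continuous_form_conjBy (X : Matrix A A ℂ) (w w' : A → ℂ) :
    Continuous fun v => form (conjBy v X) w w' := by
  have := continuous_conjBy X
  unfold form
  fun_prop

/-- Left invariance of the Haar measure: the average over `v` of a function of `⟨w, v X v* w'⟩` is
unchanged when `w` and `w'` are rotated by the same unitary. -/
theorem integral_form_mulVec (F : ℂ → ℝ) (X : Matrix A A ℂ) {U : Matrix A A ℂ} (hU : Uᴴ * U = 1)
    (w w' : A → ℂ) :
    ∫ v, F (form (conjBy v X) (U *ᵥ w) (U *ᵥ w')) ∂(unitaryHaar A) =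
      ∫ v, F (form (conjBy v X) w w') ∂(unitaryHaar A) := by
  have hU' : U * Uᴴ = 1 := mul_eq_one_comm.1 hU
  let g : unitaryGroup A ℂ := ⟨Uᴴ, by
    rw [mem_unitaryGroup_iff, star_eq_conjTranspose, conjTranspose_conjTranspose, hU]⟩
  rw [← integral_mul_left_eq_self (fun v => F (form (conjBy v X) w w')) g]
  congr 1
  ext v
  congr 1
  have h : conjBy (g * v) X = Uᴴ * conjBy v X * U := by
    simp [conjBy, g, conjTranspose_mul, Matrix.mul_assoc]
  rw [h, form, form, star_mulVec, ← dotProduct_mulVec]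
  simp [mulVec_mulVec, Matrix.mul_assoc]

/-- The second moment `∫ |⟨w, v X v* w'⟩|² dv`. -/
noncomputable def haarMoment (X : Matrix A A ℂ) (w w' : A → ℂ) : ℝ :=
  ∫ v, ‖form (conjBy v X) w w'‖ ^ 2 ∂(unitaryHaar A)

theorem integrable_form_sq (X : Matrix A A ℂ) (w w' : A → ℂ) :
    Integrable (fun v => ‖form (conjBy v X) w w'‖ ^ 2) (unitaryHaar A) :=
  integrable_unitaryHaar ((continuous_form_conjBy X w w').norm.pow 2)

/-- A pair of orthonormal vectors is the image of a pair of basis vectors under a unitary. -/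
theorem exists_unitary_mulVec_pair {w w' : A → ℂ} (hw : star w ⬝ᵥ w = 1) (hw' : star w' ⬝ᵥ w' = 1)
    (hww' : star w ⬝ᵥ w' = 0) {i j : A} (hij : i ≠ j) :
    ∃ U : Matrix A A ℂ, Uᴴ * U = 1 ∧ U *ᵥ Pi.single i 1 = w ∧ U *ᵥ Pi.single j 1 = w' := by
  have hw'w : star w' ⬝ᵥ w = 0 := by
    rw [star_dotProduct, hww', star_zero]
  obtain ⟨U, hU, hUc⟩ := exists_unitary_extending (s := {i, j})
    (c := fun n => if n = i then w else w') (by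
      rintro a (rfl | rfl) b (rfl | rfl) <;> simp [hij, hij.symm, hw, hw', hww', hw'w])
  refine ⟨U, hU, ?_, ?_⟩ <;> ext a
  · simpa using hUc i (by simp) a
  · simpa [hij.symm] using hUc j (by simp) a

theorem exists_unitary_mulVec {w : A → ℂ} (hw : star w ⬝ᵥ w = 1) (i : A) :
    ∃ U : Matrix A A ℂ, Uᴴ * U = 1 ∧ U *ᵥ Pi.single i 1 = w := by
  obtain ⟨U, hU, hUc⟩ := exists_unitary_extending (s := {i}) (c := fun _ => w) (by simp [hw])
  exact ⟨U, hU, by ext a; simpa using hUc i (by simp) a⟩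

theorem haarMoment_eq_of_orthonormal (X : Matrix A A ℂ) {w w' : A → ℂ} (hw : star w ⬝ᵥ w = 1)
    (hw' : star w' ⬝ᵥ w' = 1) (hww' : star w ⬝ᵥ w' = 0) {i j : A} (hij : i ≠ j) :
    haarMoment X w w' = haarMoment X (Pi.single i 1) (Pi.single j 1) := by
  obtain ⟨U, hU, rfl, rfl⟩ := exists_unitary_mulVec_pair hw hw' hww' hij
  exact integral_form_mulVec (fun z => ‖z‖ ^ 2) X hU _ _

theorem haarMoment_self_eq_of_unit (X : Matrix A A ℂ) {w : A → ℂ} (hw : star w ⬝ᵥ w = 1) (i : A) :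
    haarMoment X w w = haarMoment X (Pi.single i 1) (Pi.single i 1) := by
  obtain ⟨U, hU, rfl⟩ := exists_unitary_mulVec hw i
  exact integral_form_mulVec (fun z => ‖z‖ ^ 2) X hU _ _

/-- First moment: `∫ ⟨w, v X v* w⟩ dv = tr X / d` for unit vectors `w`. -/
theorem integral_form_self (X : Matrix A A ℂ) {w : A → ℂ} (hw : star w ⬝ᵥ w = 1) :
    Fintype.card A * ∫ v, (form (conjBy v X) w w).re ∂(unitaryHaar A) = X.trace.re := by
  have h1 : ∀ i : A, ∫ v, (form (conjBy v X) w w).re ∂(unitaryHaar A) =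
      ∫ v, (conjBy v X i i).re ∂(unitaryHaar A) := by
    intro i
    obtain ⟨U, hU, rfl⟩ := exists_unitary_mulVec hw i
    rw [integral_form_mulVec Complex.re X hU]
    simp_rw [form_single]
  calc Fintype.card A * ∫ v, (form (conjBy v X) w w).re ∂(unitaryHaar A)
      = ∑ i : A, ∫ v, (conjBy v X i i).re ∂(unitaryHaar A) := by
        rw [← Finset.sum_congr rfl fun i _ => h1 i]
        simp
    _ = ∫ v, ∑ i : A, (conjBy v X i i).re ∂(unitaryHaar A) := by
        rw [integral_finsetSum]
        intro i _
        refine integrable_unitaryHaar (Complex.continuous_re.comp ?_)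
        exact (continuous_conjBy X).matrix_elem i i
    _ = X.trace.re := by
        have : ∀ v, ∑ i : A, (conjBy v X i i).re = X.trace.re := by
          intro v
          rw [← trace_conjBy v X, trace, Complex.re_sum]
          rfl
        simp [this]

/-- Off-diagonal second moment. The `d (d - 1)` off-diagonal entries of `v X v*` all have the same
second moment, and together they are dominated by `‖X‖₂²`. -/
theorem haarMoment_orthonormal_le (X : Matrix A A ℂ) {w w' : A → ℂ} (hw : star w ⬝ᵥ w = 1)
    (hw' : star w' ⬝ᵥ w' = 1) (hww' : star w ⬝ᵥ w' = 0) :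
    (Fintype.card A : ℝ) * (Fintype.card A - 1) * haarMoment X w w' ≤ hsNormSq X := by
  have h1 : ∀ i j : A, i ≠ j → haarMoment X w w' = ∫ v, ‖conjBy v X i j‖ ^ 2 ∂(unitaryHaar A) := by
    intro i j hij
    rw [haarMoment_eq_of_orthonormal X hw hw' hww' hij]
    simp_rw [haarMoment, form_single]
  have hint : ∀ i j : A, Integrable (fun v => ‖conjBy v X i j‖ ^ 2) (unitaryHaar A) := fun i j =>
    integrable_unitaryHaar (((continuous_conjBy X).matrix_elem i j).norm.pow 2)
  calc (Fintype.card A : ℝ) * (Fintype.card A - 1) * haarMoment X w w'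
      = ∑ i : A, ∑ j ∈ Finset.univ.erase i, haarMoment X w w' := by
        rcases isEmpty_or_nonempty A with hA | hA
        · simp
        · simp [Finset.card_erase_of_mem, Nat.cast_sub (Fintype.card_pos (α := A))]
          ring
    _ = ∑ i : A, ∑ j ∈ Finset.univ.erase i, ∫ v, ‖conjBy v X i j‖ ^ 2 ∂(unitaryHaar A) :=
        Finset.sum_congr rfl fun i _ => Finset.sum_congr rfl fun j hj =>
          h1 i j (Finset.ne_of_mem_erase hj).symm
    _ ≤ ∑ i : A, ∑ j, ∫ v, ‖conjBy v X i j‖ ^ 2 ∂(unitaryHaar A) := by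
        refine Finset.sum_le_sum fun i _ => ?_
        exact Finset.sum_le_sum_of_subset_of_nonneg (Finset.erase_subset _ _) fun j _ _ =>
          integral_nonneg fun v => by positivity
    _ = ∫ v, hsNormSq (conjBy v X) ∂(unitaryHaar A) := by
        simp_rw [hsNormSq]
        rw [integral_finsetSum _ fun i _ => integrable_finsetSum _ fun j _ => hint i j]
        exact Finset.sum_congr rfl fun i _ => (integral_finsetSum _ fun j _ => hint i j).symm
    _ = hsNormSq X := by simp [hsNormSq_conjBy]

/-- Diagonal second moment of a traceless operator. A diagonal entry of `Y = v X v*` is the mean of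
its differences with the others, and each difference `Yᵢᵢ - Yⱼⱼ` is a combination of off-diagonal
entries of `Y`, one of them taken in a basis rotated by `45°`. -/
theorem haarMoment_self_le {X : Matrix A A ℂ} (hX : X.trace = 0) {w : A → ℂ}
    (hw : star w ⬝ᵥ w = 1) :
    (Fintype.card A : ℝ) ^ 2 * haarMoment X w w ≤ 16 * hsNormSq X := by
  rcases isEmpty_or_nonempty A with hA | ⟨⟨i⟩⟩
  · simp [hsNormSq]
  set d : ℝ := (Fintype.card A : ℝ) with hd
  have hd1 : 1 ≤ d := by
    rw [hd]; exact_mod_cast Fintype.card_pos_iff.2 ⟨i⟩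
  set s : ℂ := ((√2 : ℝ) : ℂ)⁻¹ with hs
  have hss : s * s = 1 / 2 := by
    rw [hs, ← mul_inv, ← Complex.ofReal_mul, Real.mul_self_sqrt (by norm_num)]
    norm_num
  have hsc : star s = s := by simp [hs]
  have hdiff : ∀ j, j ≠ i → ∫ v, ‖conjBy v X i i - conjBy v X j j‖ ^ 2 ∂(unitaryHaar A) ≤
      16 * hsNormSq X / (d * (d - 1)) := by
    intro j hji
    have hd2 : 0 < d - 1 := by
      have : 1 < Fintype.card A := Fintype.one_lt_card_iff.2 ⟨j, i, hji⟩
      rw [sub_pos, hd]; exact_mod_cast this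
    set p : A → ℂ := Pi.single i s + Pi.single j s with hp
    set m : A → ℂ := Pi.single i s - Pi.single j s with hm
    have hpp : star p ⬝ᵥ p = 1 := by
      simp [hp, Pi.star_single, hsc, hji, hji.symm]
      linear_combination 2 * hss
    have hmm : star m ⬝ᵥ m = 1 := by
      simp [hm, Pi.star_single, hsc, hji, hji.symm, dotProduct_sub]
      linear_combination 2 * hss
    have hpm : star p ⬝ᵥ m = 0 := by
      simp [hp, hm, Pi.star_single, hsc, hji, hji.symm]
    have hform : ∀ Y : Matrix A A ℂ, Y i i - Y j j = 2 * form Y p m + Y i j - Y j i := by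
      intro Y
      simp only [form, hp, hm, star_add, Pi.star_single, hsc, mulVec_sub, mulVec_single,
        add_dotProduct, single_dotProduct, Pi.smul_apply, col_apply,
        MulOpposite.smul_eq_mul_unop, MulOpposite.unop_op, dotProduct_sub]
      linear_combination (-2 * (Y i i - Y j j - Y i j + Y j i)) * hss
    have hpt : ∀ v, ‖conjBy v X i i - conjBy v X j j‖ ^ 2 ≤
        8 * ‖form (conjBy v X) p m‖ ^ 2 + 4 * ‖conjBy v X i j‖ ^ 2 + 4 * ‖conjBy v X j i‖ ^ 2 := by
      intro v
      rw [hform]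
      have h1 : ‖2 * form (conjBy v X) p m + conjBy v X i j - conjBy v X j i‖ ≤
          2 * ‖form (conjBy v X) p m‖ + ‖conjBy v X i j‖ + ‖conjBy v X j i‖ := by
        refine (norm_sub_le _ _).trans (add_le_add (norm_add_le_of_le ?_ le_rfl) le_rfl)
        simp
      have h0 := norm_nonneg (2 * form (conjBy v X) p m + conjBy v X i j - conjBy v X j i)
      set α := ‖form (conjBy v X) p m‖
      set β := ‖conjBy v X i j‖
      set γ := ‖conjBy v X j i‖
      have h2 := pow_le_pow_left₀ h0 h1 2
      nlinarith [sq_nonneg (α - β), sq_nonneg (α - γ), sq_nonneg (β - γ)]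
    have hij1 := haarMoment_orthonormal_le X (w := Pi.single i 1) (w' := Pi.single j 1)
      (by simp [Pi.star_single]) (by simp [Pi.star_single]) (by simp [Pi.star_single, hji])
    have hji1 := haarMoment_orthonormal_le X (w := Pi.single j 1) (w' := Pi.single i 1)
      (by simp [Pi.star_single]) (by simp [Pi.star_single]) (by simp [Pi.star_single, hji.symm])
    have hpm1 := haarMoment_orthonormal_le X hpp hmm hpm
    simp only [haarMoment, form_single] at hij1 hji1 hpm1
    have hc : ∀ a b, Continuous fun v => ‖conjBy v X a b‖ ^ 2 := fun a b =>
      ((continuous_conjBy X).matrix_elem a b).norm.pow 2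
    have hi1 := (integrable_form_sq X p m).const_mul 8
    have hi2 := (integrable_unitaryHaar (hc i j)).const_mul 4
    have hi3 := (integrable_unitaryHaar (hc j i)).const_mul 4
    have hi12 : Integrable (fun v => 8 * ‖form (conjBy v X) p m‖ ^ 2 + 4 * ‖conjBy v X i j‖ ^ 2)
        (unitaryHaar A) := hi1.add hi2
    have hle : ∫ v, ‖conjBy v X i i - conjBy v X j j‖ ^ 2 ∂(unitaryHaar A) ≤
        ∫ v, (8 * ‖form (conjBy v X) p m‖ ^ 2 + 4 * ‖conjBy v X i j‖ ^ 2 +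
          4 * ‖conjBy v X j i‖ ^ 2) ∂(unitaryHaar A) :=
      integral_mono (integrable_unitaryHaar ((((continuous_conjBy X).matrix_elem i i).sub
        ((continuous_conjBy X).matrix_elem j j)).norm.pow 2)) (hi12.add hi3) hpt
    rw [integral_add hi12 hi3, integral_add hi1 hi2, integral_const_mul, integral_const_mul,
      integral_const_mul] at hle
    rw [le_div_iff₀ (by positivity)]
    have := mul_le_mul_of_nonneg_right hle (show 0 ≤ d * (d - 1) by positivity)
    linarith
  have hpt : ∀ v, d ^ 2 * ‖conjBy v X i i‖ ^ 2 ≤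
      d * ∑ j ∈ Finset.univ.erase i, ‖conjBy v X i i - conjBy v X j j‖ ^ 2 := by
    intro v
    have h1 : ∑ j, (conjBy v X i i - conjBy v X j j) = d * conjBy v X i i := by
      have h0 : ∑ j, conjBy v X j j = 0 := (trace_conjBy v X).trans hX
      simp [Finset.sum_sub_distrib, h0, hd]
    have h2 : d * ‖conjBy v X i i‖ ≤ ∑ j, ‖conjBy v X i i - conjBy v X j j‖ := by
      calc d * ‖conjBy v X i i‖ = ‖∑ j, (conjBy v X i i - conjBy v X j j)‖ := by
            rw [h1, norm_mul, Complex.norm_real, Real.norm_of_nonneg (by positivity)]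
        _ ≤ _ := norm_sum_le _ _
    have h3 : (∑ j, ‖conjBy v X i i - conjBy v X j j‖) ^ 2 ≤
        d * ∑ j, ‖conjBy v X i i - conjBy v X j j‖ ^ 2 := by
      simpa [hd] using sq_sum_le_card_mul_sum_sq (s := Finset.univ)
        (f := fun j => ‖conjBy v X i i - conjBy v X j j‖)
    have h4 : ∑ j ∈ Finset.univ.erase i, ‖conjBy v X i i - conjBy v X j j‖ ^ 2 =
        ∑ j, ‖conjBy v X i i - conjBy v X j j‖ ^ 2 := by
      rw [← Finset.add_sum_erase _ _ (Finset.mem_univ i)]; simp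
    rw [h4, ← mul_pow]
    exact (pow_le_pow_left₀ (by positivity) h2 2).trans h3
  have hc : ∀ j, Integrable (fun v => ‖conjBy v X i i - conjBy v X j j‖ ^ 2) (unitaryHaar A) :=
    fun j => integrable_unitaryHaar ((((continuous_conjBy X).matrix_elem i i).sub
        ((continuous_conjBy X).matrix_elem j j)).norm.pow 2)
  rw [haarMoment_self_eq_of_unit X hw i, haarMoment, ← integral_const_mul]
  simp_rw [form_single]
  calc ∫ v, d ^ 2 * ‖conjBy v X i i‖ ^ 2 ∂(unitaryHaar A)
      ≤ ∫ v, d * ∑ j ∈ Finset.univ.erase i, ‖conjBy v X i i - conjBy v X j j‖ ^ 2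
          ∂(unitaryHaar A) :=
        integral_mono (integrable_unitaryHaar
          (continuous_const.mul (((continuous_conjBy X).matrix_elem i i).norm.pow 2)))
          ((integrable_finsetSum _ fun j _ => hc j).const_mul _) hpt
    _ = d * ∑ j ∈ Finset.univ.erase i,
          ∫ v, ‖conjBy v X i i - conjBy v X j j‖ ^ 2 ∂(unitaryHaar A) := by
        rw [integral_const_mul, integral_finsetSum _ fun j _ => hc j]
    _ ≤ d * ∑ j ∈ Finset.univ.erase i, 16 * hsNormSq X / (d * (d - 1)) := by
        gcongr with j hj
        exact hdiff j (Finset.ne_of_mem_erase hj)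
    _ = d * ((d - 1) * (16 * hsNormSq X / (d * (d - 1)))) := by
        rw [Finset.sum_const, Finset.card_erase_of_mem (Finset.mem_univ i), nsmul_eq_mul,
          Finset.card_univ, Nat.cast_sub (Fintype.card_pos_iff.2 ⟨i⟩), Nat.cast_one]
    _ ≤ 16 * hsNormSq X := by
        have h0 := hsNormSq_nonneg X
        rcases hd1.eq_or_lt with h | h
        · rw [← h]; simp [h0]
        · have : d - 1 ≠ 0 := by linarith
          have : d ≠ 0 := by linarith
          refine le_of_eq ?_
          field_simp

/-- Subtracting the scalar part of `X` is an orthogonal projection for the Hilbert-Schmidt norm. -/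
theorem hsNormSq_sub_trace_le (X : Matrix A A ℂ) :
    hsNormSq (X - (X.trace / Fintype.card A) • (1 : Matrix A A ℂ)) ≤ hsNormSq X := by
  rcases isEmpty_or_nonempty A with hA | hA
  · simp [hsNormSq]
  have hd : (Fintype.card A : ℂ) ≠ 0 := by simp
  have h : (X - (X.trace / Fintype.card A) • (1 : Matrix A A ℂ)) *
      (X - (X.trace / Fintype.card A) • (1 : Matrix A A ℂ))ᴴ =
      X * Xᴴ - (star (X.trace / Fintype.card A)) • X - (X.trace / Fintype.card A) • Xᴴ +
        ((X.trace / Fintype.card A) * star (X.trace / Fintype.card A)) • (1 : Matrix A A ℂ) := by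
    simp only [conjTranspose_sub, conjTranspose_smul, conjTranspose_one, Matrix.mul_sub,
      Matrix.sub_mul, Matrix.mul_smul, Matrix.smul_mul, Matrix.mul_one, Matrix.one_mul, smul_smul,
      smul_sub, mul_comm]
    abel
  rw [hsNormSq_eq_trace, hsNormSq_eq_trace, h]
  simp only [trace_add, trace_sub, trace_smul, trace_conjTranspose, trace_one, smul_eq_mul]
  have h2 : (X * Xᴴ).trace - star (X.trace / Fintype.card A) * X.trace -
      (X.trace / Fintype.card A) * star X.trace +
      (X.trace / Fintype.card A) * star (X.trace / Fintype.card A) * (Fintype.card A : ℂ) =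
      (X * Xᴴ).trace - ((‖X.trace‖ ^ 2 / Fintype.card A : ℝ) : ℂ) := by
    have h3 : ((‖X.trace‖ ^ 2 / Fintype.card A : ℝ) : ℂ) =
        X.trace * star X.trace / Fintype.card A := by
      rw [Complex.star_def, Complex.mul_conj, Complex.normSq_eq_norm_sq]; push_cast; rfl
    rw [h3, star_div₀, star_natCast]
    field_simp
    ring
  rw [h2, Complex.sub_re, Complex.ofReal_re]
  have : 0 ≤ ‖X.trace‖ ^ 2 / (Fintype.card A : ℝ) := by positivity
  linarith

omit [DecidableEq A] in
theorem mul_mul_conjTranspose_apply {K : Type*} (b : Matrix K A ℂ) (Y : Matrix A A ℂ)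
    (l l' : K) : (b * Y * bᴴ) l l' = form Y (star (b l)) (star (b l')) := by
  rw [form, star_star, Matrix.mul_assoc, Matrix.mul_apply]
  simp only [dotProduct, mulVec, Matrix.mul_apply, conjTranspose_apply, Pi.star_apply]

/-- Compressing a random rotation of `X` to `L` dimensions gives, up to an error of Hilbert-Schmidt
norm of order `(L / d) ‖X‖₂`, the scalar matrix `(tr X / d) 1`. -/
theorem integral_hsNormSq_compression_le {K : Type*} [Fintype K] [DecidableEq K]
    {b : Matrix K A ℂ} (hb : b * bᴴ = 1) (X : Matrix A A ℂ) :
    ∫ v, hsNormSq (b * conjBy v X * bᴴ - (X.trace / Fintype.card A) • (1 : Matrix K K ℂ))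
        ∂(unitaryHaar A) ≤
      16 * ((Fintype.card K : ℝ) / Fintype.card A) ^ 2 * hsNormSq X := by
  rcases isEmpty_or_nonempty K with hK | ⟨⟨k⟩⟩
  · simp [hsNormSq]
  have hA : Nonempty A := by
    by_contra hA
    rw [not_nonempty_iff] at hA
    have := congrFun (congrFun hb k) k
    simp [Matrix.mul_apply] at this
  -- the compression of the scalar part of `X` is exactly the scalar matrix that is subtracted
  set X₀ := X - (X.trace / Fintype.card A) • (1 : Matrix A A ℂ) with hX₀
  set d : ℝ := (Fintype.card A : ℝ) with hd
  have hd1 : 1 ≤ d := by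
    rw [hd]; exact_mod_cast Fintype.card_pos (α := A)
  have htr : X₀.trace = 0 := by
    have hd : (Fintype.card A : ℂ) ≠ 0 := by simp
    rw [hX₀, trace_sub, trace_smul, trace_one, smul_eq_mul]
    field_simp
    simp
  have hcomp : ∀ v, b * conjBy v X * bᴴ - (X.trace / Fintype.card A) • (1 : Matrix K K ℂ) =
      b * conjBy v X₀ * bᴴ := by
    intro v
    rw [hX₀, conjBy_sub_smul_one, Matrix.mul_sub, Matrix.sub_mul, Matrix.mul_smul, Matrix.smul_mul,
      Matrix.mul_one, hb]
  have horth : ∀ l l', star (star (b l)) ⬝ᵥ star (b l') = if l = l' then 1 else 0 := by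
    intro l l'
    rw [← Matrix.one_apply, ← hb, star_star, Matrix.mul_apply]
    rfl
  have hnn := hsNormSq_nonneg X₀
  have hentry : ∀ l l', haarMoment X₀ (star (b l)) (star (b l')) ≤ 16 * hsNormSq X₀ / d ^ 2 := by
    intro l l'
    rw [le_div_iff₀ (by positivity), mul_comm]
    by_cases h : l = l'
    · subst h
      exact haarMoment_self_le htr (by rw [horth, if_pos rfl])
    · have h1 := haarMoment_orthonormal_le X₀ (w := star (b l)) (w' := star (b l'))
        (by rw [horth, if_pos rfl]) (by rw [horth, if_pos rfl]) (by rw [horth, if_neg h])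
      have h0 : 0 ≤ haarMoment X₀ (star (b l)) (star (b l')) :=
        integral_nonneg fun v => by positivity
      have hd2 : 2 ≤ d := by
        rcases Nat.lt_or_ge 1 (Fintype.card A) with h2 | h2
        · rw [hd]; exact_mod_cast h2
        -- two orthonormal vectors do not fit into one dimension
        · exfalso
          have := Fintype.card_le_one_iff_subsingleton.1 h2
          obtain ⟨i⟩ := hA
          have e1 := horth l l
          have e2 := horth l' l'
          have e3 := horth l l'
          rw [if_pos rfl] at e1 e2
          rw [if_neg h] at e3
          rw [dotProduct, Fintype.sum_subsingleton _ i] at e1 e2 e3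
          rcases mul_eq_zero.1 e3 with e | e
          · rw [e, zero_mul] at e1; exact zero_ne_one e1
          · rw [e, mul_zero] at e2; exact zero_ne_one e2
      have hd3 : d ^ 2 ≤ 16 * (d * (d - 1)) := by nlinarith
      calc d ^ 2 * haarMoment X₀ (star (b l)) (star (b l'))
          ≤ 16 * (d * (d - 1)) * haarMoment X₀ (star (b l)) (star (b l')) := by gcongr
        _ ≤ 16 * hsNormSq X₀ := by rw [mul_assoc]; gcongr
  simp_rw [hcomp, hsNormSq, mul_mul_conjTranspose_apply]
  rw [integral_finsetSum _ fun l _ => integrable_finsetSum _ fun l' _ =>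
    integrable_form_sq X₀ _ _]
  calc ∑ l, ∫ v, ∑ l', ‖form (conjBy v X₀) (star (b l)) (star (b l'))‖ ^ 2 ∂(unitaryHaar A)
      = ∑ l, ∑ l', haarMoment X₀ (star (b l)) (star (b l')) :=
        Finset.sum_congr rfl fun l _ => integral_finsetSum _ fun l' _ => integrable_form_sq X₀ _ _
    _ ≤ ∑ l : K, ∑ l' : K, 16 * hsNormSq X₀ / d ^ 2 :=
        Finset.sum_le_sum fun l _ => Finset.sum_le_sum fun l' _ => hentry l l'
    _ = 16 * ((Fintype.card K : ℝ) / d) ^ 2 * hsNormSq X₀ := by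
        simp only [Finset.sum_const, Finset.card_univ, nsmul_eq_mul]
        field_simp
    _ ≤ 16 * ((Fintype.card K : ℝ) / d) ^ 2 * hsNormSq X := by
        gcongr
        exact hsNormSq_sub_trace_le X

end Haar

/-! ### The merging fidelity as a sum of squared overlaps -/

section Fidelity

variable {A B X ι : Type*} [Fintype A] [DecidableEq A] [Fintype B] [DecidableEq B] [Fintype X]
  [Fintype ι] {L : ℕ}

/-- The amplitude contributed by one Kraus operator `b ⊗ u` to the merging fidelity of `ρ`. It is
linear in `ρ`. -/
def overlap (φ : Fin L × Fin L → ℂ) (ρ : Matrix (A × B) (A × B) ℂ) (b : Matrix (Fin L) A ℂ)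
    (u : Matrix (Fin L × (A × B)) B ℂ) : ℂ :=
  ∑ x : Fin L × (Fin L × (A × B)), ∑ s, star (φ (x.1, x.2.1)) * (b ⊗ₖ u) x s * ρ s x.2.2

theorem mergingFidelity_eq_sum {φ : Fin L × Fin L → ℂ} (hφ : star φ ⬝ᵥ φ = 1)
    {ρ : Matrix (A × B) (A × B) ℂ} (hρ : IsState ρ) (a : ι → Matrix (Fin L) A ℂ)
    (u : ι → Matrix (Fin L × (A × B)) B ℂ) :
    mergingFidelity φ ρ (mergingMap a u) = ∑ k, ‖overlap φ ρ (a k) (u k)‖ ^ 2 :=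
  mergingFidelityOf_krausMap hφ hρ (isPurification_canonicalPurification hρ.1) _

theorem norm_eq_one_of_isMaxEntangled (hL : 0 < L) {φ : Fin L × Fin L → ℂ}
    (hφ : IsMaxEntangled φ) : star φ ⬝ᵥ φ = 1 := by
  have h := congrArg Matrix.trace hφ
  rw [trace_smul, trace_one, Fintype.card_fin, smul_eq_mul,
    inv_mul_cancel₀ (by exact_mod_cast hL.ne')] at h
  rw [← h]
  simp only [dotProduct, trace, diag_apply, trSnd, ketbra, vecMulVec_apply, of_apply,
    Fintype.sum_prod_type, mul_comm]

/-- For a purification `Ψ` of the state, the (unnormalized) vector obtained by applying `b` to the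
`A`-part, as a matrix with rows indexed by sender and reference and columns by `B`. -/
def sentMatrix (b : Matrix (Fin L) A ℂ) (Ψ : Matrix (A × B) X ℂ) : Matrix (Fin L × X) B ℂ :=
  of fun p β => ∑ a, b p.1 a * Ψ (a, β) p.2

/-- The target vector `φ ⊗ Ψ`, as a matrix with rows indexed by sender and reference and columns by
the receiver. -/
def targetMatrix (φ : Fin L × Fin L → ℂ) (Ψ : Matrix (A × B) X ℂ) :
    Matrix (Fin L × X) (Fin L × (A × B)) ℂ :=
  of fun p q => φ (p.1, q.1) * Ψ q.2 p.2

omit [DecidableEq A] [DecidableEq B] in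
theorem overlap_eq_trace (φ : Fin L × Fin L → ℂ) (Ψ : Matrix (A × B) X ℂ)
    (b : Matrix (Fin L) A ℂ) (u : Matrix (Fin L × (A × B)) B ℂ) :
    overlap φ (Ψ * Ψᴴ) b u = ((targetMatrix φ Ψ)ᴴ * sentMatrix b Ψ * uᵀ).trace := by
  simp only [overlap, trace, diag_apply, Matrix.mul_apply, conjTranspose_apply, transpose_apply,
    sentMatrix, targetMatrix, of_apply, kroneckerMap_apply, Fintype.sum_prod_type (γ := ℂ)
    (α₁ := Fin L), star_mul', Finset.mul_sum, Finset.sum_mul]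
  rw [Finset.sum_comm]
  refine Finset.sum_congr rfl fun m _ => ?_
  rw [Finset.sum_comm]
  refine Finset.sum_congr rfl fun s _ => ?_
  simp only [Fintype.sum_prod_type (γ := ℂ) (α₁ := A)]
  rw [Finset.sum_congr rfl fun l _ => Finset.sum_comm, Finset.sum_comm]
  refine Finset.sum_congr rfl fun β _ => ?_
  refine Finset.sum_congr rfl fun l _ => ?_
  rw [Finset.sum_comm]
  refine Finset.sum_congr rfl fun x _ => Finset.sum_congr rfl fun a _ => ?_
  ring

/-- The block `tr_B |Ψ_x⟩⟨Ψ_y|` of the marginal of `Ψ` on `A` and the reference. -/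
def crossMarginal (Ψ : Matrix (A × B) X ℂ) (x y : X) : Matrix A A ℂ :=
  of fun a a' => ∑ β, Ψ (a, β) x * star (Ψ (a', β) y)

/-- The marginal of `Ψ` on `A`. -/
def senderMarginal (Ψ : Matrix (A × B) X ℂ) : Matrix A A ℂ := ∑ x, crossMarginal Ψ x x

omit [DecidableEq A] [DecidableEq B] [Fintype X] in
theorem sentMatrix_mul_conjTranspose (b : Matrix (Fin L) A ℂ) (Ψ : Matrix (A × B) X ℂ)
    (p q : Fin L × X) :
    (sentMatrix b Ψ * (sentMatrix b Ψ)ᴴ) p q = (b * crossMarginal Ψ p.2 q.2 * bᴴ) p.1 q.1 := by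
  simp only [Matrix.mul_apply, conjTranspose_apply, sentMatrix, crossMarginal, of_apply, star_sum,
    star_mul', Finset.sum_mul, Finset.mul_sum]
  rw [Finset.sum_comm]
  refine Finset.sum_congr rfl fun a _ => ?_
  rw [Finset.sum_comm]
  refine Finset.sum_congr rfl fun a' _ => Finset.sum_congr rfl fun β _ => ?_
  ring

omit [DecidableEq A] [DecidableEq B] [Fintype X] in
theorem targetMatrix_mul_conjTranspose {φ : Fin L × Fin L → ℂ} (hφ : IsMaxEntangled φ)
    (Ψ : Matrix (A × B) X ℂ) (p q : Fin L × X) :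
    (targetMatrix φ Ψ * (targetMatrix φ Ψ)ᴴ) p q =
      if p.1 = q.1 then (L : ℂ)⁻¹ * (crossMarginal Ψ p.2 q.2).trace else 0 := by
  have h := congrFun (congrFun hφ p.1) q.1
  simp only [trSnd, ketbra, vecMulVec_apply, of_apply, Pi.star_apply, Matrix.smul_apply,
    Matrix.one_apply, smul_eq_mul] at h
  have h2 : (targetMatrix φ Ψ * (targetMatrix φ Ψ)ᴴ) p q =
      (∑ m, φ (p.1, m) * star (φ (q.1, m))) * (crossMarginal Ψ p.2 q.2).trace := by
    simp only [Matrix.mul_apply, conjTranspose_apply, targetMatrix, crossMarginal, of_apply,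
      star_mul', trace, diag_apply, ← Fintype.sum_prod_type', Finset.sum_mul_sum]
    refine Finset.sum_congr rfl fun _ _ => ?_
    ring
  rw [h2, h]
  split_ifs <;> simp

omit [DecidableEq A] [DecidableEq B] in
theorem trace_senderMarginal (Ψ : Matrix (A × B) X ℂ) :
    (senderMarginal Ψ).trace = (Ψ * Ψᴴ).trace := by
  simp only [senderMarginal, crossMarginal, trace, diag_apply, Matrix.sum_apply, of_apply,
    Matrix.mul_apply, conjTranspose_apply, Fintype.sum_prod_type]
  refine Finset.sum_congr rfl fun a _ => Finset.sum_comm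

omit [DecidableEq A] [DecidableEq B] in
theorem trace_targetMatrix_mul_conjTranspose (hL : 0 < L) {φ : Fin L × Fin L → ℂ}
    (hφ : IsMaxEntangled φ) (Ψ : Matrix (A × B) X ℂ) :
    (targetMatrix φ Ψ * (targetMatrix φ Ψ)ᴴ).trace = (Ψ * Ψᴴ).trace := by
  rw [← trace_senderMarginal Ψ, senderMarginal, trace_sum, trace, Fintype.sum_prod_type]
  simp only [diag_apply, targetMatrix_mul_conjTranspose hφ, if_true, Finset.sum_const,
    Finset.card_univ, Fintype.card_fin, nsmul_eq_mul]
  rw [← Finset.mul_sum, ← mul_assoc, mul_inv_cancel₀ (by exact_mod_cast hL.ne'), one_mul]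

omit [DecidableEq A] [DecidableEq B] in
theorem trace_sentMatrix_mul_conjTranspose (b : Matrix (Fin L) A ℂ) (Ψ : Matrix (A × B) X ℂ) :
    (sentMatrix b Ψ * (sentMatrix b Ψ)ᴴ).trace = (b * senderMarginal Ψ * bᴴ).trace := by
  rw [senderMarginal, Matrix.mul_sum, Matrix.sum_mul, trace_sum]
  simp only [trace, diag_apply, sentMatrix_mul_conjTranspose, Fintype.sum_prod_type]
  exact Finset.sum_comm

omit [DecidableEq A] [DecidableEq B] in
theorem posSemidef_senderMarginal (Ψ : Matrix (A × B) X ℂ) : (senderMarginal Ψ).PosSemidef := by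
  refine posSemidef_sum _ fun x _ => ?_
  have : crossMarginal Ψ x x =
      (of fun a β => Ψ (a, β) x) * (of fun a β => Ψ (a, β) x : Matrix A B ℂ)ᴴ := by
    ext a a'
    simp [crossMarginal, Matrix.mul_apply]
  rw [this]
  exact posSemidef_self_mul_conjTranspose _

theorem norm_trace_mul_sq_le {S T : Type*} [Fintype S] [Fintype T] (P : Matrix S T ℂ)
    (Q : Matrix S T ℂ) : ‖(Qᴴ * P).trace‖ ^ 2 ≤ hsNormSq Q * hsNormSq P := by
  have h1 : ‖(Qᴴ * P).trace‖ ≤ ∑ x : S × T, ‖Q x.1 x.2‖ * ‖P x.1 x.2‖ := by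
    have : (Qᴴ * P).trace = ∑ x : S × T, star (Q x.1 x.2) * P x.1 x.2 := by
      simp only [trace, diag_apply, Matrix.mul_apply, conjTranspose_apply, Fintype.sum_prod_type]
      exact Finset.sum_comm
    rw [this]
    refine (norm_sum_le _ _).trans (Finset.sum_le_sum fun x _ => ?_)
    rw [norm_mul, norm_star]
  calc ‖(Qᴴ * P).trace‖ ^ 2 ≤ (∑ x : S × T, ‖Q x.1 x.2‖ * ‖P x.1 x.2‖) ^ 2 := by gcongr
    _ ≤ (∑ x : S × T, ‖Q x.1 x.2‖ ^ 2) * ∑ x : S × T, ‖P x.1 x.2‖ ^ 2 :=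
        Finset.sum_mul_sq_le_sq_mul_sq _ _ _
    _ = hsNormSq Q * hsNormSq P := by simp only [hsNormSq, Fintype.sum_prod_type]

omit [Fintype B] in
theorem transpose_mul_conjTranspose_transpose_of_isometry {J : Type*} [Fintype J]
    {u : Matrix J B ℂ} (hu : uᴴ * u = 1) : uᵀ * (uᵀ)ᴴ = 1 := by
  have h := congrArg Matrix.transpose hu
  rw [transpose_mul, transpose_one] at h
  exact h

/-- The merging fidelity of an instrument with subnormalized Kraus operators is at most one. -/
theorem sum_norm_overlap_sq_le_one (hL : 0 < L) {φ : Fin L × Fin L → ℂ} (hφ : IsMaxEntangled φ)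
    {ρ : Matrix (A × B) (A × B) ℂ} (hρ : IsState ρ) {a : ι → Matrix (Fin L) A ℂ}
    (ha : (1 - ∑ k, (a k)ᴴ * a k).PosSemidef) {u : ι → Matrix (Fin L × (A × B)) B ℂ}
    (hu : IsIsometryFamily u) : ∑ k, ‖overlap φ ρ (a k) (u k)‖ ^ 2 ≤ 1 := by
  obtain ⟨Ψ, hΨ⟩ : ∃ Ψ : Matrix (A × B) (A × B) ℂ, ρ = Ψ * Ψᴴ := by
    have hs : (CFC.sqrt ρ)ᴴ = CFC.sqrt ρ := (CFC.sqrt_nonneg ρ).posSemidef.isHermitian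
    exact ⟨CFC.sqrt ρ, by rw [hs, CFC.sqrt_mul_sqrt_self ρ hρ.1.nonneg]⟩
  subst hΨ
  have hQ : hsNormSq (targetMatrix φ Ψ) = 1 := by
    rw [hsNormSq_eq_trace, trace_targetMatrix_mul_conjTranspose hL hφ, hρ.2, Complex.one_re]
  have hk : ∀ k, ‖overlap φ (Ψ * Ψᴴ) (a k) (u k)‖ ^ 2 ≤
      ((a k)ᴴ * a k * senderMarginal Ψ).trace.re := by
    intro k
    rw [overlap_eq_trace, Matrix.mul_assoc]
    refine (norm_trace_mul_sq_le _ _).trans ?_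
    rw [hQ, one_mul, hsNormSq_eq_trace, conjTranspose_mul, Matrix.mul_assoc,
      ← Matrix.mul_assoc (u k)ᵀ, transpose_mul_conjTranspose_transpose_of_isometry (hu k),
      Matrix.one_mul, trace_sentMatrix_mul_conjTranspose, trace_mul_comm, Matrix.mul_assoc]
  calc ∑ k, ‖overlap φ (Ψ * Ψᴴ) (a k) (u k)‖ ^ 2
      ≤ ∑ k, ((a k)ᴴ * a k * senderMarginal Ψ).trace.re := Finset.sum_le_sum fun k _ => hk k
    _ = ((∑ k, (a k)ᴴ * a k) * senderMarginal Ψ).trace.re := by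
        rw [Matrix.sum_mul, trace_sum, Complex.re_sum]
    _ ≤ (senderMarginal Ψ).trace.re := by
        have := re_trace_mul_nonneg ha (posSemidef_senderMarginal Ψ)
        rw [Matrix.sub_mul, Matrix.one_mul, trace_sub, Complex.sub_re] at this
        linarith
    _ = 1 := by rw [trace_senderMarginal, hρ.2, Complex.one_re]

/-! ### Compactness of the set of completions -/

omit [Fintype B] in
theorem isCompact_isometries {J : Type*} [Fintype J] :
    IsCompact {u : Matrix J B ℂ | uᴴ * u = 1} := by
  have hK : IsCompact (Set.pi Set.univ fun _ : J => Set.pi Set.univ fun _ : B =>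
      Metric.closedBall (0 : ℂ) 1) :=
    isCompact_univ_pi fun _ => isCompact_univ_pi fun _ => isCompact_closedBall _ _
  refine hK.of_isClosed_subset (t := {u : Matrix J B ℂ | uᴴ * u = 1}) ?_ ?_
  · exact isClosed_eq (Continuous.matrix_mul (Continuous.matrix_conjTranspose continuous_id)
      continuous_id) continuous_const
  · intro u hu j _ b _
    have h1 := congrFun (congrFun hu b) b
    simp only [Matrix.mul_apply, conjTranspose_apply, Complex.star_def, mul_comm _ (u _ _),
      Complex.mul_conj, Complex.normSq_eq_norm_sq, one_apply_eq] at h1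
    have h2 : ∑ j, ‖u j b‖ ^ 2 = 1 := by exact_mod_cast h1
    have h3 : ‖u j b‖ ^ 2 ≤ ∑ j, ‖u j b‖ ^ 2 :=
      Finset.single_le_sum (f := fun j => ‖u j b‖ ^ 2) (fun _ _ => by positivity)
        (Finset.mem_univ j)
    rw [mem_closedBall_zero_iff]
    nlinarith [norm_nonneg (u j b)]

omit [DecidableEq A] [Fintype ι] in
theorem isCompact_isIsometryFamily :
    IsCompact {u : ι → Matrix (Fin L × (A × B)) B ℂ | IsIsometryFamily u} := by
  have h := isCompact_univ_pi fun _ : ι => isCompact_isometries (B := B) (J := Fin L × (A × B))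
  convert h using 1
  ext u
  simp [IsIsometryFamily, Set.mem_pi]

omit [Fintype B] in
theorem exists_isometry {J : Type*} [Fintype J] [DecidableEq J] (e : B ↪ J) :
    ∃ u : Matrix J B ℂ, uᴴ * u = 1 := by
  refine ⟨of fun j b => if j = e b then 1 else 0, ?_⟩
  ext b b'
  simp [Matrix.mul_apply, Matrix.one_apply, eq_comm]

/-- The receiver has room for an isometric copy of `B`. -/
def receiverEmbedding (hL : 0 < L) (α : A) : B ↪ Fin L × (A × B) :=
  ⟨fun β => (⟨0, hL⟩, (α, β)), fun _ _ h => by simpa using h⟩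

omit [DecidableEq A] [DecidableEq B] in
theorem continuous_overlap {Y : Type*} [TopologicalSpace Y] (φ : Fin L × Fin L → ℂ)
    (ρ : Matrix (A × B) (A × B) ℂ) {b : Y → Matrix (Fin L) A ℂ}
    {u : Y → Matrix (Fin L × (A × B)) B ℂ} (hb : Continuous b) (hu : Continuous u) :
    Continuous fun y => overlap φ ρ (b y) (u y) := by
  have hb' : ∀ i j, Continuous fun y => b y i j := fun i j => hb.matrix_elem i j
  have hu' : ∀ i j, Continuous fun y => u y i j := fun i j => hu.matrix_elem i j
  simp only [overlap, kroneckerMap_apply]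
  fun_prop

theorem isGreatest_maxMergingFidelity (hL : 0 < L) [Nonempty A] {φ : Fin L × Fin L → ℂ}
    (hφ : star φ ⬝ᵥ φ = 1) {ρ : Matrix (A × B) (A × B) ℂ} (hρ : IsState ρ)
    (a : ι → Matrix (Fin L) A ℂ) :
    IsGreatest (completionFidelities φ ρ a) (maxMergingFidelity φ ρ a) := by
  have h : completionFidelities φ ρ a =
      (fun u : ι → Matrix (Fin L × (A × B)) B ℂ => ∑ k, ‖overlap φ ρ (a k) (u k)‖ ^ 2) ''
        {u | IsIsometryFamily u} := by
    ext x
    simp only [completionFidelities, Set.mem_ofPred_eq, Set.mem_image,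
      mergingFidelity_eq_sum hφ hρ, eq_comm]
  obtain ⟨u, hu⟩ := exists_isometry (receiverEmbedding hL (Classical.arbitrary A) (B := B))
  rw [maxMergingFidelity, h]
  refine IsCompact.isGreatest_sSup (isCompact_isIsometryFamily.image ?_)
    ⟨_, Set.mem_image_of_mem _ (show IsIsometryFamily fun _ : ι => u from fun _ => hu)⟩
  exact continuous_finsetSum _ fun k _ =>
    (continuous_overlap φ ρ continuous_const (continuous_apply k)).norm.pow 2

theorem continuous_maxMergingFidelity_rotate {φ : Fin L × Fin L → ℂ}
    (hφ : star φ ⬝ᵥ φ = 1) {ρ : Matrix (A × B) (A × B) ℂ} (hρ : IsState ρ)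
    (a : ι → Matrix (Fin L) A ℂ) :
    Continuous fun v : unitaryGroup A ℂ => maxMergingFidelity φ ρ (rotate a v) := by
  have h : ∀ v, completionFidelities φ ρ (rotate a v) =
      (fun u : ι → Matrix (Fin L × (A × B)) B ℂ =>
        ∑ k, ‖overlap φ ρ (a k * (v : Matrix A A ℂ)) (u k)‖ ^ 2) '' {u | IsIsometryFamily u} := by
    intro v
    ext x
    simp only [completionFidelities, Set.mem_ofPred_eq, Set.mem_image,
      mergingFidelity_eq_sum hφ hρ, rotate, eq_comm]
  simp only [maxMergingFidelity, h]
  refine isCompact_isIsometryFamily.continuous_sSup ?_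
  refine continuous_finsetSum _ fun k _ => (continuous_overlap φ ρ ?_ ?_).norm.pow 2
  · exact continuous_const.matrix_mul (continuous_subtype_val.comp continuous_fst)
  · exact (continuous_apply k).comp continuous_snd

/-! ### The decoupling bound -/

/-- Decoupling bound. If the state `P P*` of sender and reference after the measurement outcome is
close in (weighted) Hilbert-Schmidt norm to the multiple `c` of the product state `Q Q*`, then an
isometry of the receiver produces the target vector with squared amplitude close to the probability
of the outcome. -/
theorem exists_isometry_overlap_sq_ge (hL : 0 < L) [Nonempty A] {φ : Fin L × Fin L → ℂ}
    (hφ : IsMaxEntangled φ) [DecidableEq X] {Ψ : Matrix (A × B) X ℂ} (hΨ : (Ψ * Ψᴴ).trace = 1)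
    (b : Matrix (Fin L) A ℂ) {c : ℝ} (hc : 0 < c) {g : X → ℝ} (hg : ∀ x, 0 < g x) :
    ∃ u : Matrix (Fin L × (A × B)) B ℂ, uᴴ * u = 1 ∧
      (b * senderMarginal Ψ * bᴴ).trace.re - √(L * ∑ x, g x ^ 2) *
        √(∑ x, ∑ y, hsNormSq (b * crossMarginal Ψ x y * bᴴ -
          (c / L * (crossMarginal Ψ x y).trace) • (1 : Matrix (Fin L) (Fin L) ℂ)) / (g x * g y)) ≤
      ‖overlap φ (Ψ * Ψᴴ) b u‖ ^ 2 := by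
  set P := sentMatrix b Ψ with hP
  set Q := targetMatrix φ Ψ with hQ
  set r : ℂ := ((√c : ℝ) : ℂ) with hr
  have hrr : r * star r = (c : ℂ) := by
    rw [hr, Complex.star_def, Complex.conj_ofReal, ← Complex.ofReal_mul, Real.mul_self_sqrt hc.le]
  have hrQ : (r • Q) * (r • Q)ᴴ = (c : ℂ) • (Q * Qᴴ) := by
    rw [conjTranspose_smul, Matrix.smul_mul, Matrix.mul_smul, smul_smul, hrr]
  have hQtr : (Q * Qᴴ).trace.re = 1 := by
    rw [hQ, trace_targetMatrix_mul_conjTranspose hL hφ, hΨ, Complex.one_re]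
  set H := P * Pᴴ - (r • Q) * (r • Q)ᴴ with hH
  have hHherm : H.IsHermitian :=
    (isHermitian_mul_conjTranspose_self P).sub (isHermitian_mul_conjTranspose_self _)
  obtain ⟨Hp, Hm, U, hp, hm, hU, hHpm, hpm, hHU⟩ := exists_jordan_decomposition hHherm
  have hδ := re_trace_mul_unitary_le H hU (g := fun p : Fin L × X => g p.2) fun p => hg p.2
  rw [← hHU] at hδ
  have hHs : ∀ p q : Fin L × X, H p q = (b * crossMarginal Ψ p.2 q.2 * bᴴ -
      (c / L * (crossMarginal Ψ p.2 q.2).trace) • (1 : Matrix (Fin L) (Fin L) ℂ)) p.1 q.1 := by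
    intro p q
    rw [hH, Matrix.sub_apply, hP, sentMatrix_mul_conjTranspose, hrQ, Matrix.smul_apply, hQ,
      targetMatrix_mul_conjTranspose hφ, Matrix.sub_apply, Matrix.smul_apply, Matrix.one_apply]
    congr 1
    split_ifs <;> simp
    ring
  have hδ1 : ∑ p : Fin L × X, g p.2 ^ 2 = L * ∑ x, g x ^ 2 := by
    simp [Fintype.sum_prod_type]
  have hδ2 : ∑ p : Fin L × X, ∑ q : Fin L × X, ‖H p q‖ ^ 2 / (g p.2 * g q.2) =
      ∑ x, ∑ y, hsNormSq (b * crossMarginal Ψ x y * bᴴ -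
        (c / L * (crossMarginal Ψ x y).trace) • (1 : Matrix (Fin L) (Fin L) ℂ)) /
          (g x * g y) := by
    simp only [hHs, Fintype.sum_prod_type, hsNormSq, Finset.sum_div]
    rw [Finset.sum_comm]
    refine Finset.sum_congr rfl fun x _ => ?_
    rw [Finset.sum_congr rfl fun l _ => Finset.sum_comm, Finset.sum_comm]
  simp only [hδ1, hδ2] at hδ
  set δ := √(L * ∑ x, g x ^ 2) *
        √(∑ x, ∑ y, hsNormSq (b * crossMarginal Ψ x y * bᴴ -
          (c / L * (crossMarginal Ψ x y).trace) • (1 : Matrix (Fin L) (Fin L) ℂ)) / (g x * g y))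
  obtain ⟨u₀, hu₀⟩ := exists_isometry (receiverEmbedding hL (Classical.arbitrary A) (B := B))
  obtain ⟨u, hu, hmax⟩ := (isCompact_isometries (B := B) (J := Fin L × (A × B))).exists_isMaxOn
    ⟨u₀, hu₀⟩ (continuous_overlap φ (Ψ * Ψᴴ) (continuous_const (y := b))
      continuous_id).norm.continuousOn
  refine ⟨u, hu, ?_⟩
  set s := ‖overlap φ (Ψ * Ψᴴ) b u‖ with hs
  have hkey : ((P * Pᴴ).trace.re + c - δ) / 2 ≤ √c * s := by
    refine le_of_forall_pos_sub_le fun η hη => ?_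
    -- the error `ε * card` of the overlap bound is made smaller than `η`
    set n : ℝ := (Fintype.card (Fin L × X) : ℝ) with hn
    have hn0 : 0 ≤ n := by positivity
    obtain ⟨W, hW, hle⟩ := exists_contraction_re_trace_ge P (r • Q) hp hm hHpm hpm
      (show 0 < η / (n + 1) by positivity)
    obtain ⟨u', hu', hle'⟩ := exists_isometry_re_trace_ge
      (receiverEmbedding hL (Classical.arbitrary A)) ((r • Q)ᴴ * P) hW
    have h1 : ((r • Q)ᴴ * P * u'ᵀ).trace.re ≤ √c * s := by
      have h2 : ((r • Q)ᴴ * P * u'ᵀ).trace = ((√c : ℝ) : ℂ) * overlap φ (Ψ * Ψᴴ) b u' := by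
        rw [overlap_eq_trace, conjTranspose_smul, Matrix.smul_mul, Matrix.smul_mul, trace_smul,
          smul_eq_mul, hr, Complex.star_def, Complex.conj_ofReal]
      rw [h2, Complex.re_ofReal_mul]
      refine mul_le_mul_of_nonneg_left ?_ (Real.sqrt_nonneg c)
      exact (Complex.re_le_norm _).trans (hmax hu')
    have h3 : ((r • Q) * (r • Q)ᴴ).trace.re = c := by
      rw [hrQ, trace_smul, smul_eq_mul, Complex.re_ofReal_mul, hQtr, mul_one]
    have h4 : η / (n + 1) * n ≤ η := by
      rw [div_mul_eq_mul_div, div_le_iff₀ (by positivity)]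
      nlinarith
    rw [h3] at hle
    linarith
  have hPtr : (P * Pᴴ).trace.re = (b * senderMarginal Ψ * bᴴ).trace.re := by
    rw [hP, trace_sentMatrix_mul_conjTranspose]
  have hsq := Real.sq_sqrt hc.le
  -- `s² ≥ 2 √c s - c` linearizes the square without a case distinction on signs
  nlinarith [sq_nonneg (s - √c)]

end Fidelity

/-! ### Instruments -/

section Instruments

variable {A : Type*} [Fintype A] {L : ℕ}
  {a : Fin (Fintype.card A / L + 1) → Matrix (Fin L) A ℂ}

theorem eq_one_of_idempotent_of_rank {n : ℕ} {G : Matrix (Fin n) (Fin n) ℂ} (hG : G * G = G)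
    (hr : G.rank = n) : G = 1 := by
  have htop : LinearMap.range G.mulVecLin = ⊤ :=
    Submodule.eq_top_of_finrank_eq (by simpa [Matrix.rank] using hr)
  rw [LinearMap.range_eq_top] at htop
  refine Matrix.ext_of_mulVec_single fun i => ?_
  obtain ⟨y, hy⟩ := htop (Pi.single i 1)
  rw [mulVecLin_apply] at hy
  rw [← hy, mulVec_mulVec, hG, one_mulVec]

theorem IsLInstrument.mul_conjTranspose_self (ha : IsLInstrument L a)
    {k : Fin (Fintype.card A / L + 1)} (hk : k ≠ 0) : a k * (a k)ᴴ = 1 := by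
  refine eq_one_of_idempotent_of_rank ?_ ?_
  · rw [← Matrix.mul_assoc, ha.partialIsometry]
  · rw [rank_self_mul_conjTranspose, ha.rank_eq k hk]

variable [DecidableEq A]

/-- The initial projections of an instrument are orthogonal, so their sum is a projection. -/
theorem IsLInstrument.posSemidef_one_sub_sum (ha : IsLInstrument L a) :
    (1 - ∑ k, (a k)ᴴ * a k).PosSemidef := by
  set S := ∑ k, (a k)ᴴ * a k with hS
  have hSh : Sᴴ = S := by
    simp [hS, conjTranspose_sum]
  have hSS : S * S = S := by
    rw [hS, Finset.sum_mul]
    refine Finset.sum_congr rfl fun k _ => ?_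
    rw [Finset.mul_sum, Finset.sum_eq_single k]
    · rw [Matrix.mul_assoc, ← Matrix.mul_assoc (a k), ha.partialIsometry]
    · intro j _ hjk
      rw [Matrix.mul_assoc, ← Matrix.mul_assoc (a k), ha.orthogonal k j hjk.symm, Matrix.zero_mul,
        Matrix.mul_zero]
    · simp
  have h : 1 - S = (1 - S)ᴴ * (1 - S) := by
    rw [conjTranspose_sub, conjTranspose_one, hSh, Matrix.mul_sub, Matrix.sub_mul, Matrix.sub_mul,
      hSS, Matrix.one_mul, Matrix.mul_one, Matrix.one_mul]
    simp
  rw [h]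
  exact posSemidef_conjTranspose_mul_self _

theorem rotate_mul_conjTranspose_rotate {ι : Type*} (b : ι → Matrix (Fin L) A ℂ)
    (v : unitaryGroup A ℂ) (j k : ι) : rotate b v j * (rotate b v k)ᴴ = b j * (b k)ᴴ := by
  simp only [rotate, conjTranspose_mul, Matrix.mul_assoc]
  rw [← Matrix.mul_assoc (v : Matrix A A ℂ), coe_mul_conjTranspose_self, Matrix.one_mul]

theorem IsLInstrument.rotate (ha : IsLInstrument L a) (v : unitaryGroup A ℂ) :
    IsLInstrument L (rotate a v) := by
  have hrank : ∀ k, (StateMerging.rotate a v k).rank = (a k).rank := fun k => by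
    rw [← rank_self_mul_conjTranspose, rotate_mul_conjTranspose_rotate,
      rank_self_mul_conjTranspose]
  refine ⟨fun k => ?_, fun k hk => ?_, ?_, fun j k hjk => ?_⟩
  · rw [rotate_mul_conjTranspose_rotate, StateMerging.rotate, ← Matrix.mul_assoc,
      ha.partialIsometry]
  · rw [hrank, ha.rank_eq k hk]
  · rw [hrank, ha.rank_zero]
  · rw [rotate_mul_conjTranspose_rotate, ha.orthogonal j k hjk]

omit [DecidableEq A] in
/-- An instrument is obtained by cutting the standard basis into blocks of length `L`, the outcome
`0` taking the incomplete last block. -/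
theorem exists_isLInstrument (hL : 0 < L) :
    ∃ a : Fin (Fintype.card A / L + 1) → Matrix (Fin L) A ℂ, IsLInstrument L a := by
  set d := Fintype.card A with hd
  set D := d / L with hD
  let e : A ≃ Fin d := Fintype.equivFin A
  -- row `l` of outcome `k` is the basis vector number `pos k l`, or zero beyond `d`
  let blk : Fin (D + 1) → ℕ := fun k => if k = 0 then D else k - 1
  have hblk : ∀ j k, blk j = blk k → j = k := by
    intro j k h
    have hj := j.isLt
    have hk := k.isLt
    simp only [blk] at h
    split_ifs at h with h1 h2 h2
    · rw [h1, h2]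
    · rw [← Fin.val_eq_zero_iff] at h2; omega
    · rw [← Fin.val_eq_zero_iff] at h1; omega
    · rw [← Fin.val_eq_zero_iff] at h1 h2; ext; omega
  let pos : Fin (D + 1) → Fin L → ℕ := fun k l => L * blk k + l
  have hpos : ∀ j k l m, pos j l = pos k m → j = k ∧ l = m := by
    intro j k l m h
    have hdiv : ∀ n (i : Fin L), (L * n + i) / L = n := fun n i => by
      rw [Nat.mul_add_div hL, Nat.div_eq_of_lt i.isLt, add_zero]
    have h1 : blk j = blk k := by
      rw [← hdiv (blk j) l, ← hdiv (blk k) m]; exact congrArg (· / L) h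
    refine ⟨hblk j k h1, ?_⟩
    simp only [pos, h1] at h
    ext; omega
  let a : Fin (D + 1) → Matrix (Fin L) A ℂ := fun k => of fun l α =>
    if pos k l = (e α : ℕ) then 1 else 0
  have haa : ∀ j k l m, (a j * (a k)ᴴ) l m =
      if pos j l = pos k m ∧ pos j l < d then 1 else 0 := by
    intro j k l m
    simp only [a, Matrix.mul_apply, conjTranspose_apply, of_apply, apply_ite star, star_one,
      star_zero, mul_ite, mul_one, mul_zero]
    split_ifs with h
    · rw [Finset.sum_eq_single (e.symm ⟨pos j l, h.2⟩)]
      · simp [h.1]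
      · intro α _ hα
        split_ifs with h1 h2
        · exact absurd (by rw [Equiv.eq_symm_apply]; ext; exact h2.symm) hα
        · rfl
        · rfl
      · simp
    · refine Finset.sum_eq_zero fun α _ => ?_
      split_ifs with h1 h2
      · exact absurd ⟨h2.trans h1.symm, h2 ▸ (e α).isLt⟩ h
      · rfl
      · rfl
  have hdiag : ∀ k, a k * (a k)ᴴ = diagonal fun l => if pos k l < d then 1 else 0 := by
    intro k
    ext l m
    rw [haa, diagonal_apply]
    by_cases h : l = m
    · subst h; simp
    · rw [if_neg h, if_neg fun h' => h (hpos k k l m h'.1).2]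
  have hrank : ∀ k, (a k).rank = Fintype.card {l : Fin L // pos k l < d} := by
    intro k
    rw [← rank_self_mul_conjTranspose, hdiag, rank_diagonal]
    exact Fintype.card_congr (Equiv.subtypeEquivRight fun l => by simp)
  refine ⟨a, fun k => ?_, fun k hk => ?_, ?_, fun j k hjk => ?_⟩
  · rw [hdiag]
    ext l α
    rw [diagonal_mul]
    by_cases h : pos k l < d
    · simp [h]
    · have : a k l α = 0 := if_neg fun h' : pos k l = e α => h (h' ▸ (e α).isLt)
      rw [this, mul_zero]
  · rw [hrank, Fintype.card_of_subtype Finset.univ, Finset.card_univ, Fintype.card_fin]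
    intro l
    simp only [Finset.mem_univ, true_iff, pos, blk, if_neg hk]
    have h1 : (k : ℕ) - 1 + 1 ≤ D := by
      have : (k : ℕ) < D + 1 := k.isLt
      have : (k : ℕ) ≠ 0 := fun h => hk (Fin.val_eq_zero_iff.1 h)
      omega
    have h2 : L * ((k : ℕ) - 1 + 1) ≤ d :=
      (Nat.mul_le_mul_left L h1).trans (Nat.mul_div_le d L)
    have := l.isLt
    rw [mul_add, mul_one] at h2
    omega
  · have h1 : d - L * D ≤ L := by
      have : d < L * (D + 1) := Nat.lt_mul_div_succ d hL
      rw [mul_add, mul_one] at this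
      omega
    rw [hrank, Fintype.card_subtype]
    have h2 : ∀ l : Fin L, pos 0 l < d ↔ (l : ℕ) < d - L * D := by
      intro l
      simp only [pos, blk, if_true]
      omega
    simp only [h2]
    rw [Fin.card_filter_val_lt, min_eq_right h1]
  · ext l m
    rw [haa, if_neg fun h => hjk (hpos j k l m h.1).1]
    rfl

end Instruments

/-! ### Purifications of minimal dimension and the averaged state -/

section Purification

variable {A B : Type*} [Fintype A] [DecidableEq A] [Fintype B] [DecidableEq B]

/-- A state has a purification whose reference system has the rank of the state as its dimension. -/
theorem exists_minimal_purification {S : Type*} [Fintype S] [DecidableEq S] {ρ : Matrix S S ℂ}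
    (hρ : ρ.PosSemidef) : ∃ χ : Matrix S (Fin ρ.rank) ℂ, χ * χᴴ = ρ := by
  obtain ⟨V, hV, hV', hρV⟩ := exists_diagonalization hρ.isHermitian
  set lam := hρ.isHermitian.eigenvalues with hlam
  have hlam0 : ∀ i, 0 ≤ lam i := hρ.eigenvalues_nonneg
  let e : Fin ρ.rank ≃ {i // lam i ≠ 0} :=
    (Fintype.equivFinOfCardEq hρ.isHermitian.rank_eq_card_non_zero_eigs.symm).symm
  refine ⟨of fun s n => V s (e n) * ((√(lam (e n)) : ℝ) : ℂ), ?_⟩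
  ext s t
  simp only [Matrix.mul_apply, conjTranspose_apply, of_apply]
  rw [e.sum_comp fun i : {i // lam i ≠ 0} =>
    V s i * ((√(lam i) : ℝ) : ℂ) * star (V t i * ((√(lam i) : ℝ) : ℂ))]
  conv_rhs => rw [hρV, Matrix.mul_apply]
  simp only [mul_diagonal, conjTranspose_apply]
  have h : ∀ i, V s i * ((√(lam i) : ℝ) : ℂ) * star (V t i * ((√(lam i) : ℝ) : ℂ)) =
      V s i * (lam i : ℂ) * star (V t i) := by
    intro i
    have h2 : (lam i : ℂ) = ((√(lam i) : ℝ) : ℂ) * ((√(lam i) : ℝ) : ℂ) := by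
      rw [← Complex.ofReal_mul, Real.mul_self_sqrt (hlam0 i)]
    simp only [star_mul', Complex.star_def, Complex.conj_ofReal]
    rw [h2]
    ring
  simp only [h]
  rw [← Finset.sum_subtype (Finset.univ.filter fun i => lam i ≠ 0) (by simp)
    fun i => V s i * (lam i : ℂ) * star (V t i)]
  refine Finset.sum_filter_of_ne fun i _ hi hlam => hi ?_
  rw [hlam]; simp

theorem rank_trFst_ketbra {S E : Type*} [Fintype S] [DecidableEq S] [Fintype E] {ρ : Matrix S S ℂ}
    {ψ : S × E → ℂ} (hψ : IsPurification ψ ρ) : (trFst (ketbra ψ)).rank = ρ.rank := by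
  set M : Matrix S E ℂ := of fun s e => ψ (s, e) with hM
  have h1 : ρ = M * Mᴴ := by
    rw [← hψ]
    ext s t
    simp [trSnd, ketbra, vecMulVec_apply, Matrix.mul_apply, hM]
  have h2 : trFst (ketbra ψ) = Mᵀ * (Mᵀ)ᴴ := by
    ext e f
    simp [trFst, ketbra, vecMulVec_apply, Matrix.mul_apply, hM]
  rw [h1, h2, rank_self_mul_conjTranspose, rank_self_mul_conjTranspose, rank_transpose]

theorem isState_averageState {S : Type*} [Fintype S] {N : ℕ} (hN : 0 < N)
    {ρ : Fin N → Matrix S S ℂ} (hρ : ∀ i, IsState (ρ i)) : IsState (averageState ρ) := by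
  refine ⟨(posSemidef_sum _ fun i _ => (hρ i).1).smul ?_, ?_⟩
  · rw [← Complex.ofReal_natCast, ← Complex.ofReal_inv, Complex.zero_le_real]
    positivity
  · rw [averageState, trace_smul, trace_sum, Finset.sum_congr rfl fun i _ => (hρ i).2]
    simp [hN.ne']

theorem IsState.rank_pos {S : Type*} [Fintype S] [DecidableEq S] {ρ : Matrix S S ℂ}
    (hρ : IsState ρ) : 0 < ρ.rank := by
  refine Nat.pos_of_ne_zero fun h => ?_
  obtain ⟨χ, hχ⟩ := exists_minimal_purification hρ.1
  have : IsEmpty (Fin ρ.rank) := by rw [h]; infer_instance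
  have h0 : ρ = 0 := by
    rw [← hχ]; ext s t; simp [Matrix.mul_apply]
  have := hρ.2
  rw [h0, trace_zero] at this
  exact zero_ne_one this

omit [DecidableEq A] [DecidableEq B] in
/-- The operators `tr_B |χ_e⟩⟨ω_f|` are controlled, in Hilbert-Schmidt norm, by the marginals of `χ`
and `ω` on `B`. -/
theorem sum_hsNormSq_cross_le {R R' : Type*} [Fintype R] [Fintype R'] (χ : Matrix (A × B) R ℂ)
    (ω : Matrix (A × B) R' ℂ) :
    ∑ e, ∑ f, hsNormSq (of fun a a' => ∑ β, χ (a, β) e * star (ω (a', β) f)) ≤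
      √(hsNormSq (trFst (χ * χᴴ))) * √(hsNormSq (trFst (ω * ωᴴ))) := by
  set P : Matrix B (A × R) ℂ := of fun β p => χ (p.1, β) p.2 with hP
  set Q : Matrix B (A × R') ℂ := of fun β p => ω (p.1, β) p.2 with hQ
  have hPP : P * Pᴴ = trFst (χ * χᴴ) := by
    ext β β'
    simp [hP, trFst, Matrix.mul_apply, Fintype.sum_prod_type]
  have hQQ : Q * Qᴴ = trFst (ω * ωᴴ) := by
    ext β β'
    simp [hQ, trFst, Matrix.mul_apply, Fintype.sum_prod_type]
  have hsum : ∑ e, ∑ f, hsNormSq (of fun a a' => ∑ β, χ (a, β) e * star (ω (a', β) f)) =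
      hsNormSq (Pᵀ * (Qᵀ)ᴴ) := by
    simp only [hsNormSq, Fintype.sum_prod_type, of_apply, Matrix.mul_apply, conjTranspose_apply,
      transpose_apply, hP, hQ]
    rw [Finset.sum_congr rfl fun e _ => Finset.sum_comm, Finset.sum_comm]
    refine Finset.sum_congr rfl fun a _ => Finset.sum_congr rfl fun e _ => ?_
    rw [Finset.sum_comm]
  have hswap : hsNormSq (Pᵀ * (Qᵀ)ᴴ) = hsNormSq (Qᴴ * P) := by
    simp only [hsNormSq, Matrix.mul_apply, conjTranspose_apply, transpose_apply]
    rw [Finset.sum_comm]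
    simp only [mul_comm]
  have htr : hsNormSq (Qᴴ * P) = (((Q * Qᴴ)ᴴ) * (P * Pᴴ)).trace.re := by
    rw [hsNormSq_eq_trace]
    simp only [conjTranspose_mul, conjTranspose_conjTranspose]
    rw [← Matrix.mul_assoc, trace_mul_comm]
    simp only [Matrix.mul_assoc]
  rw [hsum, hswap, htr, ← hPP, ← hQQ, ← Real.sqrt_mul (hsNormSq_nonneg _), mul_comm]
  refine (Complex.re_le_norm _).trans (Real.le_sqrt_of_sq_le ?_)
  exact norm_trace_mul_sq_le _ _

end Purification

/-! ### The average merging fidelity of a randomly rotated instrument -/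

section Average

variable {A B X : Type*} [Fintype A] [DecidableEq A] [Fintype B] [DecidableEq B] [Fintype X]
  {L : ℕ}

/-- The weighted squared Hilbert-Schmidt distance, after the measurement outcome `b v`, between the
joint state of sender and reference and its mean over `v`. -/
noncomputable def fluctuation (b : Matrix (Fin L) A ℂ) (Ψ : Matrix (A × B) X ℂ) (g : X → ℝ)
    (v : unitaryGroup A ℂ) : ℝ :=
  ∑ x, ∑ y, hsNormSq (b * conjBy v (crossMarginal Ψ x y) * bᴴ -
    ((crossMarginal Ψ x y).trace / Fintype.card A) • (1 : Matrix (Fin L) (Fin L) ℂ)) / (g x * g y)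

/-- The same weighted squared norm of the joint state of `A` and the reference itself. -/
noncomputable def weightedNorm (Ψ : Matrix (A × B) X ℂ) (g : X → ℝ) : ℝ :=
  ∑ x, ∑ y, hsNormSq (crossMarginal Ψ x y) / (g x * g y)

omit [DecidableEq B] in
theorem continuous_hsNormSq_compression (b : Matrix (Fin L) A ℂ) (Y : Matrix A A ℂ) (c : ℂ) :
    Continuous fun v => hsNormSq (b * conjBy v Y * bᴴ - c • (1 : Matrix (Fin L) (Fin L) ℂ)) := by
  have h : Continuous fun v => b * conjBy v Y * bᴴ - c • (1 : Matrix (Fin L) (Fin L) ℂ) :=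
    ((continuous_const.matrix_mul (continuous_conjBy Y)).matrix_mul continuous_const).sub
      continuous_const
  have h' := fun i j => h.matrix_elem i j
  unfold hsNormSq
  fun_prop

omit [DecidableEq B] in
theorem continuous_fluctuation (b : Matrix (Fin L) A ℂ) (Ψ : Matrix (A × B) X ℂ) (g : X → ℝ) :
    Continuous (fluctuation b Ψ g) :=
  continuous_finsetSum _ fun x _ => continuous_finsetSum _ fun y _ =>
    (continuous_hsNormSq_compression b (crossMarginal Ψ x y) _).div_const _

omit [DecidableEq B] in
theorem fluctuation_nonneg (b : Matrix (Fin L) A ℂ) (Ψ : Matrix (A × B) X ℂ) {g : X → ℝ}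
    (hg : ∀ x, 0 < g x) (v : unitaryGroup A ℂ) : 0 ≤ fluctuation b Ψ g v :=
  Finset.sum_nonneg fun x _ => Finset.sum_nonneg fun y _ =>
    div_nonneg (hsNormSq_nonneg _) (mul_pos (hg x) (hg y)).le

omit [DecidableEq B] in
theorem integral_fluctuation_le {b : Matrix (Fin L) A ℂ} (hb : b * bᴴ = 1)
    (Ψ : Matrix (A × B) X ℂ) {g : X → ℝ} (hg : ∀ x, 0 < g x) :
    ∫ v, fluctuation b Ψ g v ∂(unitaryHaar A) ≤
      16 * ((L : ℝ) / Fintype.card A) ^ 2 * weightedNorm Ψ g := by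
  have hint : ∀ x y, Integrable (fun v => hsNormSq (b * conjBy v (crossMarginal Ψ x y) * bᴴ -
    ((crossMarginal Ψ x y).trace / Fintype.card A) • (1 : Matrix (Fin L) (Fin L) ℂ)) /
      (g x * g y)) (unitaryHaar A) := fun x y =>
    integrable_unitaryHaar ((continuous_hsNormSq_compression b _ _).div_const _)
  simp only [fluctuation, weightedNorm, Finset.mul_sum]
  rw [integral_finsetSum _ fun x _ => integrable_finsetSum _ fun y _ => hint x y]
  refine Finset.sum_le_sum fun x _ => ?_
  rw [integral_finsetSum _ fun y _ => hint x y]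
  refine Finset.sum_le_sum fun y _ => ?_
  rw [integral_div, ← mul_div_assoc]
  refine div_le_div_of_nonneg_right ?_ (mul_pos (hg x) (hg y)).le
  simpa using integral_hsNormSq_compression_le hb (crossMarginal Ψ x y)

theorem integral_sqrt_le {f : unitaryGroup A ℂ → ℝ} (hf : Continuous f) (hf0 : ∀ v, 0 ≤ f v) :
    ∫ v, √(f v) ∂(unitaryHaar A) ≤ √(∫ v, f v ∂(unitaryHaar A)) := by
  set m := ∫ v, √(f v) ∂(unitaryHaar A) with hm
  refine Real.le_sqrt_of_sq_le ?_
  have h1 : ∀ v, 2 * m * √(f v) - m ^ 2 ≤ f v := by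
    intro v
    nlinarith [sq_nonneg (√(f v) - m), Real.sq_sqrt (hf0 v)]
  have hi := (integrable_unitaryHaar hf.sqrt).const_mul (2 * m)
  have h2 := integral_mono (hi.sub (integrable_const (m ^ 2))) (integrable_unitaryHaar hf) h1
  have h3 : ∫ v, (2 * m * √(f v) - m ^ 2) ∂(unitaryHaar A) = m ^ 2 := by
    rw [integral_sub hi (integrable_const _), integral_const_mul, ← hm]
    simp
    ring
  exact h3 ▸ h2

/-- The probability of an outcome of rank `L` is `L / d` on average. -/
theorem integral_trace_compression {b : Matrix (Fin L) A ℂ} (hb : b * bᴴ = 1) [Nonempty A]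
    {σ : Matrix A A ℂ} (hσ : σ.trace = 1) :
    ∫ v, (b * conjBy v σ * bᴴ).trace.re ∂(unitaryHaar A) = (L : ℝ) / Fintype.card A := by
  have hd : (Fintype.card A : ℝ) ≠ 0 := by simp
  have hunit : ∀ l, star (star (b l)) ⬝ᵥ star (b l) = 1 := by
    intro l
    have := congrFun (congrFun hb l) l
    rw [one_apply_eq, Matrix.mul_apply] at this
    rw [star_star]
    exact this
  have hint : ∀ l, Integrable (fun v => (form (conjBy v σ) (star (b l)) (star (b l))).re)
      (unitaryHaar A) := fun l =>
    integrable_unitaryHaar (Complex.continuous_re.comp (continuous_form_conjBy σ _ _))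
  simp only [trace, diag_apply, Complex.re_sum, mul_mul_conjTranspose_apply]
  rw [integral_finsetSum _ fun l _ => hint l]
  have h : ∀ l, ∫ v, (form (conjBy v σ) (star (b l)) (star (b l))).re ∂(unitaryHaar A) =
      1 / Fintype.card A := by
    intro l
    have := integral_form_self σ (hunit l)
    rw [hσ, Complex.one_re] at this
    rw [eq_div_iff hd, mul_comm, this]
  simp only [h, Finset.sum_const, Finset.card_univ, Fintype.card_fin, nsmul_eq_mul]
  ring

/-- For a fixed rotation, the optimal merging fidelity is at least the probability of the outcomes
`k ≠ 0`, less their fluctuations. -/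
theorem sum_le_maxMergingFidelity (hL : 0 < L) [Nonempty A] {φ : Fin L × Fin L → ℂ}
    (hφ : IsMaxEntangled φ) [DecidableEq X] {Ψ : Matrix (A × B) X ℂ} (hΨ : IsState (Ψ * Ψᴴ))
    {ι : Type*} [Fintype ι] (a : ι → Matrix (Fin L) A ℂ) (s : Finset ι)
    {g : X → ℝ} (hg : ∀ x, 0 < g x) (v : unitaryGroup A ℂ) :
    ∑ k ∈ s, ((a k * conjBy v (senderMarginal Ψ) * (a k)ᴴ).trace.re -
        √(L * ∑ x, g x ^ 2) * √(fluctuation (a k) Ψ g v)) ≤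
      maxMergingFidelity φ (Ψ * Ψᴴ) (rotate a v) := by
  have hφ1 := norm_eq_one_of_isMaxEntangled hL hφ
  have hd : (0 : ℝ) < Fintype.card A := by exact_mod_cast Fintype.card_pos (α := A)
  have hconj : ∀ k Y, rotate a v k * Y * (rotate a v k)ᴴ = a k * conjBy v Y * (a k)ᴴ := by
    intro k Y
    simp only [rotate, conjBy, conjTranspose_mul, Matrix.mul_assoc]
  have hc : ∀ z : ℂ, (((L : ℝ) / Fintype.card A : ℝ) : ℂ) / L * z = z / Fintype.card A := by
    intro z
    have h1 : (L : ℂ) ≠ 0 := by exact_mod_cast hL.ne'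
    have h2 : (Fintype.card A : ℂ) ≠ 0 := by exact_mod_cast hd.ne'
    push_cast
    field_simp
  have hu : ∀ k, ∃ u : Matrix (Fin L × (A × B)) B ℂ, uᴴ * u = 1 ∧
      (a k * conjBy v (senderMarginal Ψ) * (a k)ᴴ).trace.re -
        √(L * ∑ x, g x ^ 2) * √(fluctuation (a k) Ψ g v) ≤
      ‖overlap φ (Ψ * Ψᴴ) (rotate a v k) u‖ ^ 2 := by
    intro k
    obtain ⟨u, hu, hle⟩ := exists_isometry_overlap_sq_ge hL hφ hΨ.2 (rotate a v k)
      (show (0 : ℝ) < L / Fintype.card A from div_pos (by exact_mod_cast hL) hd) hg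
    simp only [hconj, hc] at hle
    exact ⟨u, hu, hle⟩
  choose u hu hle using hu
  calc _ ≤ ∑ k ∈ s, ‖overlap φ (Ψ * Ψᴴ) (rotate a v k) (u k)‖ ^ 2 :=
        Finset.sum_le_sum fun k _ => hle k
    _ ≤ ∑ k, ‖overlap φ (Ψ * Ψᴴ) (rotate a v k) (u k)‖ ^ 2 :=
        Finset.sum_le_sum_of_subset_of_nonneg (Finset.subset_univ s) fun _ _ _ => by positivity
    _ ≤ maxMergingFidelity φ (Ψ * Ψᴴ) (rotate a v) :=
        (isGreatest_maxMergingFidelity hL hφ1 hΨ (rotate a v)).2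
          ⟨u, hu, (mergingFidelity_eq_sum hφ1 hΨ _ _).symm⟩

/-- Averaged over the rotations, the outcomes of rank `L` lose only the weight `L / d` of the
remaining outcome and their fluctuations. -/
theorem le_integral_maxMergingFidelity (hL : 0 < L) [Nonempty A] {φ : Fin L × Fin L → ℂ}
    (hφ : IsMaxEntangled φ) [DecidableEq X] {Ψ : Matrix (A × B) X ℂ} (hΨ : IsState (Ψ * Ψᴴ))
    {a : Fin (Fintype.card A / L + 1) → Matrix (Fin L) A ℂ} (ha : IsLInstrument L a)
    {g : X → ℝ} (hg : ∀ x, 0 < g x) :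
    1 - (L : ℝ) / Fintype.card A - 4 * (√(L * ∑ x, g x ^ 2) * √(weightedNorm Ψ g)) ≤
      ∫ v, maxMergingFidelity φ (Ψ * Ψᴴ) (rotate a v) ∂(unitaryHaar A) := by
  have hφ1 := norm_eq_one_of_isMaxEntangled hL hφ
  have hd : (0 : ℝ) < Fintype.card A := by exact_mod_cast Fintype.card_pos (α := A)
  set d : ℝ := (Fintype.card A : ℝ) with hd'
  set t := √(L * ∑ x, g x ^ 2) with ht
  set w := weightedNorm Ψ g with hw
  have hσ : (senderMarginal Ψ).trace = 1 := by rw [trace_senderMarginal, hΨ.2]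
  set s : Finset (Fin (Fintype.card A / L + 1)) := Finset.univ.erase 0 with hs
  have hi1 : ∀ k, Integrable (fun v => (a k * conjBy v (senderMarginal Ψ) * (a k)ᴴ).trace.re)
      (unitaryHaar A) := fun k => by
    refine integrable_unitaryHaar (Complex.continuous_re.comp ?_)
    exact ((continuous_const.matrix_mul (continuous_conjBy _)).matrix_mul
      continuous_const).matrix_trace
  have hi2 : ∀ k, Integrable (fun v => t * √(fluctuation (a k) Ψ g v)) (unitaryHaar A) := fun k =>
    (integrable_unitaryHaar (continuous_fluctuation (a k) Ψ g).sqrt).const_mul t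
  have hk : ∀ k ∈ s, (L : ℝ) / d - t * (4 * (L / d) * √w) ≤
      ∫ v, ((a k * conjBy v (senderMarginal Ψ) * (a k)ᴴ).trace.re -
        t * √(fluctuation (a k) Ψ g v)) ∂(unitaryHaar A) := by
    intro k hks
    have hb := ha.mul_conjTranspose_self (Finset.ne_of_mem_erase hks)
    rw [integral_sub (hi1 k) (hi2 k), integral_trace_compression hb hσ, integral_const_mul]
    refine sub_le_sub_left (mul_le_mul_of_nonneg_left ?_ (Real.sqrt_nonneg _)) _
    calc ∫ v, √(fluctuation (a k) Ψ g v) ∂(unitaryHaar A)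
        ≤ √(∫ v, fluctuation (a k) Ψ g v ∂(unitaryHaar A)) :=
          integral_sqrt_le (continuous_fluctuation _ _ _) (fluctuation_nonneg _ _ hg)
      _ ≤ √(16 * ((L : ℝ) / d) ^ 2 * w) := Real.sqrt_le_sqrt (integral_fluctuation_le hb Ψ hg)
      _ = 4 * (L / d) * √w := by
          have : 16 * ((L : ℝ) / d) ^ 2 = (4 * (L / d)) ^ 2 := by ring
          rw [this, Real.sqrt_mul (by positivity), Real.sqrt_sq (by positivity)]
  obtain ⟨D, hD⟩ : ∃ D, D = Fintype.card A / L := ⟨_, rfl⟩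
  have hD1 : (D : ℝ) * L ≤ d := by
    rw [hd', hD]; exact_mod_cast Nat.div_mul_le_self _ _
  have hD2 : d ≤ D * L + L := by
    have := (Nat.lt_mul_div_succ (Fintype.card A) hL).le
    rw [mul_add, mul_one, mul_comm] at this
    rw [hd', hD]; exact_mod_cast this
  have htw : 0 ≤ t * √w := mul_nonneg (Real.sqrt_nonneg _) (Real.sqrt_nonneg _)
  calc 1 - (L : ℝ) / d - 4 * (t * √w)
      ≤ D * ((L : ℝ) / d - t * (4 * (L / d) * √w)) := by
        have e1 : (D : ℝ) * ((L : ℝ) / d - t * (4 * (L / d) * √w)) =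
            (D * L) / d - (D * L) / d * (4 * (t * √w)) := by ring
        have e2 : (D * L : ℝ) / d ≤ 1 := (div_le_one hd).2 hD1
        have e3 : 1 - (L : ℝ) / d ≤ D * L / d := by
          rw [sub_le_iff_le_add, ← add_div, one_le_div hd]
          exact hD2
        rw [e1]
        nlinarith
    _ = ∑ k ∈ s, ((L : ℝ) / d - t * (4 * (L / d) * √w)) := by
        rw [Finset.sum_const, hs, Finset.card_erase_of_mem (Finset.mem_univ _), Finset.card_univ,
          Fintype.card_fin, Nat.add_sub_cancel, ← hD, nsmul_eq_mul]
    _ ≤ ∑ k ∈ s, ∫ v, ((a k * conjBy v (senderMarginal Ψ) * (a k)ᴴ).trace.re -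
          t * √(fluctuation (a k) Ψ g v)) ∂(unitaryHaar A) := Finset.sum_le_sum hk
    _ = ∫ v, ∑ k ∈ s, ((a k * conjBy v (senderMarginal Ψ) * (a k)ᴴ).trace.re -
          t * √(fluctuation (a k) Ψ g v)) ∂(unitaryHaar A) :=
        (integral_finsetSum _ fun k _ => (hi1 k).sub (hi2 k)).symm
    _ ≤ ∫ v, maxMergingFidelity φ (Ψ * Ψᴴ) (rotate a v) ∂(unitaryHaar A) :=
        integral_mono (integrable_finsetSum _ fun k _ => (hi1 k).sub (hi2 k))
          (integrable_unitaryHaar (continuous_maxMergingFidelity_rotate hφ1 hΨ a))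
          (sum_le_maxMergingFidelity hL hφ hΨ a s hg)

/-- The averaged state has a purification, with block-diagonal weights adapted to the ranks of the
`ρᵢ`, for which the trace norm bound of the fluctuations is the sum of the individual bounds. -/
theorem exists_purification_averageState (hL : 0 < L) {N : ℕ} (hN : 0 < N)
    {ρ : Fin N → Matrix (A × B) (A × B) ℂ} (hρ : ∀ i, IsState (ρ i)) :
    ∃ (Ψ : Matrix (A × B) (Σ i, Fin (ρ i).rank) ℂ) (g : (Σ i, Fin (ρ i).rank) → ℝ),
      Ψ * Ψᴴ = averageState ρ ∧ (∀ x, 0 < g x) ∧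
      √(L * ∑ x, g x ^ 2) * √(weightedNorm Ψ g) ≤
        ∑ i, √((L : ℝ) * (ρ i).rank * hsNormSq (trFst (ρ i))) := by
  choose χ hχ using fun i => exists_minimal_purification (hρ i).1
  have hL' : (0 : ℝ) < L := by exact_mod_cast hL
  have hr : ∀ i, (0 : ℝ) < (ρ i).rank := fun i => by exact_mod_cast (hρ i).rank_pos
  have hN' : (0 : ℝ) < N := by exact_mod_cast hN
  set κ : Fin N → ℝ := fun i => √((L : ℝ) * (ρ i).rank) with hκ
  have hκ0 : ∀ i, 0 < κ i := fun i => Real.sqrt_pos.2 (mul_pos hL' (hr i))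
  have hκsq : ∀ i, κ i ^ 2 = L * (ρ i).rank := fun i => Real.sq_sqrt (mul_pos hL' (hr i)).le
  set h : Fin N → ℝ := fun i => √(hsNormSq (trFst (ρ i))) with hh
  set n : ℂ := ((√(N : ℝ) : ℝ) : ℂ)⁻¹ with hn
  have hnn : n * star n = (N : ℂ)⁻¹ := by
    rw [hn, star_inv₀, Complex.star_def, Complex.conj_ofReal, ← mul_inv, ← Complex.ofReal_mul,
      Real.mul_self_sqrt hN'.le, Complex.ofReal_natCast]
  set Ψ : Matrix (A × B) (Σ i, Fin (ρ i).rank) ℂ := of fun s x => n * χ x.1 s x.2 with hΨ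
  refine ⟨Ψ, fun x => (κ x.1)⁻¹, ?_, fun x => inv_pos.2 (hκ0 _), ?_⟩
  · ext s t
    rw [averageState, Matrix.smul_apply, Matrix.sum_apply, smul_eq_mul, Finset.mul_sum,
      Matrix.mul_apply, Fintype.sum_sigma]
    refine Finset.sum_congr rfl fun i _ => ?_
    have hi := congrFun (congrFun (hχ i) s) t
    rw [← hi, Matrix.mul_apply, Finset.mul_sum]
    refine Finset.sum_congr rfl fun e _ => ?_
    rw [← hnn, conjTranspose_apply, conjTranspose_apply, hΨ, of_apply, of_apply, star_mul']
    ring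
  have hg2 : (L : ℝ) * ∑ x : Σ i, Fin (ρ i).rank, (κ x.1)⁻¹ ^ 2 = N := by
    rw [Fintype.sum_sigma]
    simp only [inv_pow, hκsq, Finset.sum_const, Finset.card_univ, Fintype.card_fin, nsmul_eq_mul]
    have : ∀ i, ((ρ i).rank : ℝ) * ((L : ℝ) * (ρ i).rank)⁻¹ = (L : ℝ)⁻¹ := fun i => by
      have := (hr i).ne'
      field_simp
    simp only [this, Finset.sum_const, Finset.card_univ, Fintype.card_fin, nsmul_eq_mul]
    field_simp
  have hcross : ∀ (i j : Fin N) (e : Fin (ρ i).rank) (f : Fin (ρ j).rank),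
      hsNormSq (crossMarginal Ψ ⟨i, e⟩ ⟨j, f⟩) = ((N : ℝ) ^ 2)⁻¹ *
        hsNormSq (of fun a a' => ∑ β, χ i (a, β) e * star (χ j (a', β) f)) := by
    intro i j e f
    simp only [hsNormSq, Finset.mul_sum, crossMarginal, of_apply]
    refine Finset.sum_congr rfl fun a _ => Finset.sum_congr rfl fun a' _ => ?_
    have h1 : ∑ β, Ψ (a, β) ⟨i, e⟩ * star (Ψ (a', β) ⟨j, f⟩) =
        (N : ℂ)⁻¹ * ∑ β, χ i (a, β) e * star (χ j (a', β) f) := by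
      rw [Finset.mul_sum, ← hnn]
      refine Finset.sum_congr rfl fun β _ => ?_
      rw [hΨ, of_apply, of_apply, star_mul']
      ring
    rw [h1, norm_mul, mul_pow, norm_inv, Complex.norm_natCast, inv_pow]
  have hw : weightedNorm Ψ (fun x => (κ x.1)⁻¹) ≤ ((N : ℝ) ^ 2)⁻¹ * (∑ i, κ i * h i) ^ 2 := by
    have h1 : weightedNorm Ψ (fun x => (κ x.1)⁻¹) = ∑ i, ∑ j, κ i * κ j * (((N : ℝ) ^ 2)⁻¹ *
        ∑ e, ∑ f, hsNormSq (of fun a a' => ∑ β, χ i (a, β) e * star (χ j (a', β) f))) := by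
      simp only [weightedNorm, Fintype.sum_sigma, hcross, Finset.mul_sum]
      refine Finset.sum_congr rfl fun i _ => ?_
      rw [Finset.sum_comm]
      refine Finset.sum_congr rfl fun j _ => Finset.sum_congr rfl fun e _ =>
        Finset.sum_congr rfl fun f _ => ?_
      rw [← mul_inv, div_inv_eq_mul]
      ring
    rw [h1, sq (∑ i, κ i * h i), Finset.sum_mul_sum, Finset.mul_sum]
    refine Finset.sum_le_sum fun i _ => ?_
    rw [Finset.mul_sum]
    refine Finset.sum_le_sum fun j _ => ?_
    have h2 := sum_hsNormSq_cross_le (χ i) (χ j)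
    rw [hχ, hχ] at h2
    calc _ ≤ κ i * κ j * (((N : ℝ) ^ 2)⁻¹ * (h i * h j)) := by
          have := (hκ0 i).le
          have := (hκ0 j).le
          gcongr
      _ = _ := by ring
  have hx : ∀ i, √((L : ℝ) * (ρ i).rank * hsNormSq (trFst (ρ i))) = κ i * h i := fun i =>
    Real.sqrt_mul (mul_pos hL' (hr i)).le _
  simp only [hx, hg2]
  have hsum : 0 ≤ ∑ i, κ i * h i :=
    Finset.sum_nonneg fun i _ => mul_nonneg (hκ0 i).le (Real.sqrt_nonneg _)
  rw [← Real.sqrt_mul hN'.le]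
  refine Real.sqrt_le_iff.2 ⟨hsum, ?_⟩
  calc (N : ℝ) * weightedNorm Ψ (fun x => (κ x.1)⁻¹)
      ≤ N * (((N : ℝ) ^ 2)⁻¹ * (∑ i, κ i * h i) ^ 2) := by gcongr
    _ = (N : ℝ)⁻¹ * (∑ i, κ i * h i) ^ 2 := by field_simp
    _ ≤ 1 * (∑ i, κ i * h i) ^ 2 := by
        gcongr
        exact inv_le_one_of_one_le₀ (by exact_mod_cast hN)
    _ = _ := one_mul _

end Average

/-! ### From the averaged state to the individual states -/

section Individual

variable {A B : Type*} [Fintype A] [DecidableEq A] [Fintype B] [DecidableEq B] {L N : ℕ}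

omit [DecidableEq A] [DecidableEq B] in
theorem overlap_averageState (φ : Fin L × Fin L → ℂ) (ρ : Fin N → Matrix (A × B) (A × B) ℂ)
    (b : Matrix (Fin L) A ℂ) (u : Matrix (Fin L × (A × B)) B ℂ) :
    overlap φ (averageState ρ) b u = (N : ℂ)⁻¹ * ∑ i, overlap φ (ρ i) b u := by
  simp only [overlap, averageState, Matrix.smul_apply, Matrix.sum_apply, smul_eq_mul,
    Finset.mul_sum]
  conv_rhs => rw [Finset.sum_comm]
  refine Finset.sum_congr rfl fun x _ => ?_
  conv_rhs => rw [Finset.sum_comm]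
  refine Finset.sum_congr rfl fun s _ => Finset.sum_congr rfl fun i _ => ?_
  ring

/-- The merging fidelity is convex in the state, so that a fidelity close to one for the average
forces a fidelity close to one for every state. -/
theorem le_mergingFidelity_of_averageState (hL : 0 < L) (hN : 0 < N) {φ : Fin L × Fin L → ℂ}
    (hφ : IsMaxEntangled φ) {ρ : Fin N → Matrix (A × B) (A × B) ℂ} (hρ : ∀ i, IsState (ρ i))
    {a : Fin (Fintype.card A / L + 1) → Matrix (Fin L) A ℂ} (ha : IsLInstrument L a)
    {u : Fin (Fintype.card A / L + 1) → Matrix (Fin L × (A × B)) B ℂ} (hu : IsIsometryFamily u)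
    {δ : ℝ} (hδ : 1 - δ ≤ mergingFidelity φ (averageState ρ) (mergingMap a u)) (i : Fin N) :
    1 - N * δ ≤ mergingFidelity φ (ρ i) (mergingMap a u) := by
  have hφ1 := norm_eq_one_of_isMaxEntangled hL hφ
  have hN' : (0 : ℝ) < N := by exact_mod_cast hN
  have hle : ∀ j, mergingFidelity φ (ρ j) (mergingMap a u) ≤ 1 := fun j => by
    rw [mergingFidelity_eq_sum hφ1 (hρ j)]
    exact sum_norm_overlap_sq_le_one hL hφ (hρ j) ha.posSemidef_one_sub_sum hu
  have hconv : N * mergingFidelity φ (averageState ρ) (mergingMap a u) ≤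
      ∑ j, mergingFidelity φ (ρ j) (mergingMap a u) := by
    simp only [mergingFidelity_eq_sum hφ1 (hρ _),
      mergingFidelity_eq_sum hφ1 (isState_averageState hN hρ)]
    rw [Finset.sum_comm, Finset.mul_sum]
    refine Finset.sum_le_sum fun k _ => ?_
    rw [overlap_averageState, norm_mul, mul_pow, norm_inv, Complex.norm_natCast, inv_pow]
    have h1 : ‖∑ j, overlap φ (ρ j) (a k) (u k)‖ ^ 2 ≤
        N * ∑ j, ‖overlap φ (ρ j) (a k) (u k)‖ ^ 2 := by
      refine (pow_le_pow_left₀ (norm_nonneg _) (norm_sum_le _ _) 2).trans ?_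
      simpa using sq_sum_le_card_mul_sum_sq (s := Finset.univ)
        (f := fun j => ‖overlap φ (ρ j) (a k) (u k)‖)
    calc _ ≤ (N : ℝ) * (((N : ℝ) ^ 2)⁻¹ * (N * ∑ j, ‖overlap φ (ρ j) (a k) (u k)‖ ^ 2)) := by
          gcongr
      _ = _ := by field_simp
  have hrest : ∑ j ∈ Finset.univ.erase i, mergingFidelity φ (ρ j) (mergingMap a u) ≤ N - 1 := by
    calc _ ≤ ∑ j ∈ Finset.univ.erase i, (1 : ℝ) := Finset.sum_le_sum fun j _ => hle j
      _ = N - 1 := by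
        rw [Finset.sum_const, Finset.card_erase_of_mem (Finset.mem_univ i), Finset.card_univ,
          Fintype.card_fin, nsmul_eq_mul, mul_one, Nat.cast_sub hN, Nat.cast_one]
  rw [← Finset.add_sum_erase _ _ (Finset.mem_univ i)] at hconv
  have := mul_le_mul_of_nonneg_left hδ hN'.le
  linarith

end Individual

end StateMerging

open StateMerging
theorem mainTheorem2 {A B E : Type*} [Fintype A] [DecidableEq A] [Fintype B] [DecidableEq B]
    [Fintype E] (L N : ℕ) (hL : 0 < L) (hLA : L ≤ Fintype.card A) (hN : 0 < N)
    (φ : Fin L × Fin L → ℂ) (hφ : IsMaxEntangled φ)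
    (ρ : Fin N → Matrix (A × B) (A × B) ℂ) (hρ : ∀ i, IsState (ρ i))
    (ψ : Fin N → (A × B) × E → ℂ) (hψ : ∀ i, IsPurification (ψ i) (ρ i)) :
    (∀ a : Fin (Fintype.card A / L + 1) → Matrix (Fin L) A ℂ, IsLInstrument L a →
      (∀ v : unitaryGroup A ℂ,
        IsGreatest (completionFidelities φ (averageState ρ) (rotate a v))
          (maxMergingFidelity φ (averageState ρ) (rotate a v))) ∧
      Integrable (fun v => maxMergingFidelity φ (averageState ρ) (rotate a v)) (unitaryHaar A) ∧
      1 - 2 * errorTerm L ψ ≤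
        ∫ v, maxMergingFidelity φ (averageState ρ) (rotate a v) ∂(unitaryHaar A) ∧
      (∃ v : unitaryGroup A ℂ,
        1 - 2 * errorTerm L ψ ≤ maxMergingFidelity φ (averageState ρ) (rotate a v)) ∧
      ∀ v : unitaryGroup A ℂ,
        1 - 2 * errorTerm L ψ ≤ maxMergingFidelity φ (averageState ρ) (rotate a v) →
        ∀ u : Fin (Fintype.card A / L + 1) → Matrix (Fin L × (A × B)) B ℂ,
          IsIsometryFamily u →
          mergingFidelity φ (averageState ρ) (mergingMap (rotate a v) u) =
            maxMergingFidelity φ (averageState ρ) (rotate a v) →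
          1 - 2 * errorTerm L ψ ≤
            mergingFidelity φ (averageState ρ) (mergingMap (rotate a v) u) ∧
          ∀ i, 1 - 2 * N * errorTerm L ψ ≤
            mergingFidelity φ (ρ i) (mergingMap (rotate a v) u)) ∧
    ∃ M : Matrix (A × B) (A × B) ℂ →ₗ[ℂ]
        Matrix (Fin L × (Fin L × (A × B))) (Fin L × (Fin L × (A × B))) ℂ,
      IsLMerging L M ∧
      1 - 2 * errorTerm L ψ ≤ mergingFidelity φ (averageState ρ) M ∧
      ∀ i, 1 - 2 * N * errorTerm L ψ ≤ mergingFidelity φ (ρ i) M := by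
  have hφ1 := norm_eq_one_of_isMaxEntangled hL hφ
  have hA : Nonempty A := Fintype.card_pos_iff.1 (hL.trans_le hLA)
  have hav := isState_averageState hN hρ
  have hgreatest : ∀ a : Fin (Fintype.card A / L + 1) → Matrix (Fin L) A ℂ,
      IsGreatest (completionFidelities φ (averageState ρ) a)
        (maxMergingFidelity φ (averageState ρ) a) :=
    isGreatest_maxMergingFidelity hL hφ1 hav
  have hint : ∀ a : Fin (Fintype.card A / L + 1) → Matrix (Fin L) A ℂ,
      Integrable (fun v => maxMergingFidelity φ (averageState ρ) (rotate a v)) (unitaryHaar A) :=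
    fun a => integrable_unitaryHaar (continuous_maxMergingFidelity_rotate hφ1 hav a)
  have hbound : ∀ a : Fin (Fintype.card A / L + 1) → Matrix (Fin L) A ℂ, IsLInstrument L a →
      1 - 2 * errorTerm L ψ ≤
        ∫ v, maxMergingFidelity φ (averageState ρ) (rotate a v) ∂(unitaryHaar A) := by
    intro a ha
    obtain ⟨Ψ, g, hΨ, hg, hle⟩ := exists_purification_averageState hL hN hρ
    have h := le_integral_maxMergingFidelity hL hφ (Ψ := Ψ) (by rw [hΨ]; exact hav) ha hg
    rw [hΨ] at h
    have herr : errorTerm L ψ = (L : ℝ) / Fintype.card A +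
        2 * ∑ i, √((L : ℝ) * (ρ i).rank * hsNormSq (trFst (ρ i))) := by
      rw [errorTerm]
      congr 2
      refine Finset.sum_congr rfl fun i _ => ?_
      rw [rank_trFst_ketbra (hψ i), hψ i]
    have : 0 ≤ (L : ℝ) / Fintype.card A := by positivity
    rw [herr]
    linarith
  have hexists : ∀ a : Fin (Fintype.card A / L + 1) → Matrix (Fin L) A ℂ, IsLInstrument L a →
      ∃ v : unitaryGroup A ℂ,
        1 - 2 * errorTerm L ψ ≤ maxMergingFidelity φ (averageState ρ) (rotate a v) := by
    intro a ha
    obtain ⟨v, hv⟩ := exists_integral_le (hint a)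
    exact ⟨v, (hbound a ha).trans hv⟩
  have hmerge : ∀ a : Fin (Fintype.card A / L + 1) → Matrix (Fin L) A ℂ, IsLInstrument L a →
      ∀ v : unitaryGroup A ℂ,
        1 - 2 * errorTerm L ψ ≤ maxMergingFidelity φ (averageState ρ) (rotate a v) →
        ∀ u : Fin (Fintype.card A / L + 1) → Matrix (Fin L × (A × B)) B ℂ,
          IsIsometryFamily u →
          mergingFidelity φ (averageState ρ) (mergingMap (rotate a v) u) =
            maxMergingFidelity φ (averageState ρ) (rotate a v) →
          1 - 2 * errorTerm L ψ ≤
            mergingFidelity φ (averageState ρ) (mergingMap (rotate a v) u) ∧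
          ∀ i, 1 - 2 * N * errorTerm L ψ ≤
            mergingFidelity φ (ρ i) (mergingMap (rotate a v) u) := by
    intro a ha v hv u hu hmax
    rw [← hmax] at hv
    refine ⟨hv, fun i => ?_⟩
    have := le_mergingFidelity_of_averageState hL hN hφ hρ (ha.rotate v) hu hv i
    linarith
  refine ⟨fun a ha => ⟨fun v => hgreatest _, hint a, hbound a ha, hexists a ha, hmerge a ha⟩, ?_⟩
  obtain ⟨a, ha⟩ := exists_isLInstrument (A := A) hL
  obtain ⟨v, hv⟩ := hexists a ha
  obtain ⟨u, hu, hmax⟩ := (hgreatest (rotate a v)).1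
  exact ⟨mergingMap (rotate a v) u, ⟨rotate a v, u, ha.rotate v, hu, rfl⟩,
    hmerge a ha v hv u hu hmax.symm⟩
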